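/- Let $\mathbb K$ be a normed division algebra, i.e. a finite-dimensional, not necessarily associative real algebra with unit and conjugation $*$, with $\mathrm{Re}(a)=\frac12(a+a^*)\in\mathbb R$ and with norm $|a|=\sqrt{aa^*}$ satisfying $|ab|=|a||b|$. Let $V=\mathfrak h_2(\mathbb K)$ be the real vector space of hermitian $2\times2$ matrices over $\mathbb K$, with the Minkowski metric $g$ determined by $g(A,A)=-\det A$, and let $S_+=\mathbb K^2$. For $\mathbb K=\mathbb R,\mathbb C,\mathbb H,\mathbb O$ the dimension of $V$ is $3,4,6,10$. Put $\tilde A=A-(\mathrm{tr}\,A)1$ and $\psi\cdot\phi=\widetilde{\psi\phi^\dagger+\phi\psi^\dagger}\in V$ for $\psi,\phi\in S_+$. The supertranslation algebra $T=V\oplus S_+$ is the Lie superalgebra with even part $V$, odd part $S_+$, and bracket $[(A,\psi),(B,\phi)]=(\psi\cdot\phi,0)$. Let $\alpha:\Lambda^3T\to\mathbb R$ be the unique super-skew-symmetric trilinear form with $\alpha(\psi,\phi,A)=g(\psi\cdot\phi,A)$ for $\psi,\phi\in S_+$, $A\in V$, that vanishes on homogeneous arguments unless one is a vector and two are spinors.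 A Lie $n$-superalgebra is an $L_\infty$-superalgebra (a $\mathbb Z_2$-graded chain complex with super-antisymmetric, parity-preserving brackets $l_k$ of degree $k-2$, $k\ge1$, satisfying the generalized Jacobi identities) whose nonzero terms have degrees in $\{0,\dots,n-1\}$. For $m\ge1$, an $L_\infty$-superalgebra whose only nonzero terms are $V_0$ and $V_m$ and whose differential $l_1$ vanishes corresponds to the quadruple $(\mathfrak g,R,\rho,\omega)$ with $\mathfrak g=V_0$ (a Lie superalgebra under $l_2$), $R=V_m$, $\rho(x)f=l_2(x,f)$, and $\omega=l_{m+2}|_{\mathfrak g}$, an even $(m+2)$-cocycle on $\mathfrak g$ with values in $R$. For $n\ge2$, a Lie $n$-superalgebra is exact if it is of this form with $m=n-1$ and $\omega$ is a coboundary. Then there exists a non-exact Lie 2-superalgebra $A$ that corresponds, up to isomorphism of the quadruple, to $(T,\mathbb R,0,\alpha)$, where $\mathbb R$ is purely even with the trivial action of $T$; in particular $\alpha$ is an even 3-cocycle. Moreover $A$ is an extension of $T$: there is a short exact sequence $0\to b\mathbb R\to A\to T\to0$ of $L_\infty$-superalgebras, where $b\mathbb R$ is the abelian one with $\mathbb R$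 in degree 1 and all other terms zero. In particular this holds in spacetime dimensions $3,4,6$ and $10$. -/

import Mathlib

/-! ## Normed division algebras -/

/-- A normed division algebra, presented through its conjugation `star`: a nonzero
finite-dimensional real unital algebra, not assumed associative, with an involution such that
`a + a* = 2 Re(a) 1` is real and such that the norm `|a| = √(Re (a a*))` is positive definite and
satisfies `|a b| = |a| |b|`. -/
class NormedDivisionAlgebra (K : Type*) [NonAssocRing K] [StarRing K] [Module ℝ K] : Type _
    extends IsScalarTower ℝ K K, SMulCommClass ℝ K K, StarModule ℝ K, Module.Finite ℝ K,
      Nontrivial K where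
  /-- The real part. -/
  re : K →ₗ[ℝ] ℝ
  add_star_eq : ∀ a : K, a + star a = (2 * re a) • (1 : K)
  normSq_pos : ∀ a : K, a ≠ 0 → 0 < re (a * star a)
  normSq_mul : ∀ a b : K,
    re ((a * b) * star (a * b)) = re (a * star a) * re (b * star b)

/-- The octonions, as the Cayley-Dickson double of the quaternions. -/
def Octonion : Type := Quaternion ℝ × Quaternion ℝ

noncomputable section Octonions

namespace Octonion

instance : AddCommGroup Octonion := inferInstanceAs (AddCommGroup (Quaternion ℝ × Quaternion ℝ))

instance : Module ℝ Octonion := inferInstanceAs (Module ℝ (Quaternion ℝ × Quaternion ℝ))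

/-- `(a, b) (c, d) = (a c - d* b, d a + b c*)`. -/
instance : Mul Octonion :=
  ⟨fun x y => (x.1 * y.1 - star y.2 * x.2, y.2 * x.1 + x.2 * star y.1)⟩

instance : One Octonion := ⟨(1, 0)⟩

/-- `(a, b)* = (a*, -b)`. -/
instance : Star Octonion := ⟨fun x => (star x.1, -x.2)⟩

theorem ext {x y : Octonion} (h₁ : x.1 = y.1) (h₂ : x.2 = y.2) : x = y := Prod.ext h₁ h₂

@[simp] theorem add_fst (x y : Octonion) : (x + y).1 = x.1 + y.1 := rfl
@[simp] theorem add_snd (x y : Octonion) : (x + y).2 = x.2 + y.2 := rfl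
@[simp] theorem zero_fst : (0 : Octonion).1 = 0 := rfl
@[simp] theorem zero_snd : (0 : Octonion).2 = 0 := rfl
@[simp] theorem one_fst : (1 : Octonion).1 = 1 := rfl
@[simp] theorem one_snd : (1 : Octonion).2 = 0 := rfl
@[simp] theorem smul_fst (r : ℝ) (x : Octonion) : (r • x).1 = r • x.1 := rfl
@[simp] theorem smul_snd (r : ℝ) (x : Octonion) : (r • x).2 = r • x.2 := rfl
@[simp] theorem mul_fst (x y : Octonion) : (x * y).1 = x.1 * y.1 - star y.2 * x.2 := rfl
@[simp] theorem mul_snd (x y : Octonion) : (x * y).2 = y.2 * x.1 + x.2 * star y.1 := rfl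
@[simp] theorem star_fst (x : Octonion) : (star x).1 = star x.1 := rfl
@[simp] theorem star_snd (x : Octonion) : (star x).2 = -x.2 := rfl

instance : NonAssocRing Octonion :=
  { (inferInstance : AddCommGroup Octonion), (inferInstance : Mul Octonion),
    (inferInstance : One Octonion) with
    left_distrib := fun x y z => by
      apply ext <;> simp [mul_add, add_mul] <;> abel
    right_distrib := fun x y z => by
      apply ext <;> simp [mul_add, add_mul] <;> abel
    zero_mul := fun x => by apply ext <;> simp
    mul_zero := fun x => by apply ext <;> simp
    one_mul := fun x => by apply ext <;> simp
    mul_one := fun x => by apply ext <;> simp }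

instance : StarRing Octonion where
  star_involutive x := by apply ext <;> simp
  star_mul x y := by
    apply ext <;> simp
  star_add x y := by
    apply ext
    · simp
    · simp; abel

instance : Nontrivial Octonion := inferInstanceAs (Nontrivial (Quaternion ℝ × Quaternion ℝ))

instance : NormedDivisionAlgebra Octonion where
  smul_assoc r x y := by apply ext <;> simp [smul_sub]
  smul_comm r x y := by apply ext <;> simp [smul_sub]
  star_smul r x := by apply ext <;> simp
  fg_top := (inferInstance : Module.Finite ℝ (Quaternion ℝ × Quaternion ℝ)).fg_top
  exists_pair_ne := exists_pair_ne Octonion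
  re :=
    { toFun := fun x => x.1.re
      map_add' := fun _ _ => rfl
      map_smul' := fun _ _ => rfl }
  add_star_eq x := by
    apply ext
    · change x.1 + star x.1 = (2 * x.1.re) • (1 : Quaternion ℝ)
      rw [Quaternion.self_add_star]
      simp [Algebra.smul_def]
      exact Or.inl rfl
    · simp
  normSq_pos x hx := by
    have h : x.1 ≠ 0 ∨ x.2 ≠ 0 := by
      by_contra! h
      exact hx (ext h.1 h.2)
    have e : (x * star x).1.re = Quaternion.normSq x.1 + Quaternion.normSq x.2 := by
      simp [Quaternion.normSq_def']; ring
    have h₁ := Quaternion.normSq_nonneg (a := x.1)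
    have h₂ := Quaternion.normSq_nonneg (a := x.2)
    change 0 < (x * star x).1.re
    rw [e]
    rcases h with h | h
    · have := lt_of_le_of_ne h₁ (Ne.symm (Quaternion.normSq_ne_zero.2 h))
      linarith
    · have := lt_of_le_of_ne h₂ (Ne.symm (Quaternion.normSq_ne_zero.2 h))
      linarith
  normSq_mul x y := by
    change ((x * y) * star (x * y)).1.re = (x * star x).1.re * (y * star y).1.re
    simp
    ring

end Octonion

instance : NormedDivisionAlgebra ℝ where
  re := LinearMap.id
  add_star_eq a := by simp [two_mul]
  normSq_pos a ha := by simpa using mul_self_pos.2 ha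
  normSq_mul a b := by simp; ring

instance : NormedDivisionAlgebra ℂ where
  re := Complex.reLm
  add_star_eq a := by apply Complex.ext <;> simp [two_mul]
  normSq_pos a ha := by
    have := Complex.normSq_pos.2 ha
    simpa [Complex.normSq_apply] using this
  normSq_mul a b := by simp; ring

instance : NormedDivisionAlgebra (Quaternion ℝ) where
  star_smul r x := by ext <;> simp
  re :=
    { toFun := fun x => x.re
      map_add' := fun _ _ => rfl
      map_smul' := fun _ _ => rfl }
  add_star_eq a := by
    change a + star a = (2 * a.re) • (1 : Quaternion ℝ)
    rw [Quaternion.self_add_star]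
    simp [Algebra.smul_def]
    exact Or.inl rfl
  normSq_pos a ha := by
    have h := lt_of_le_of_ne (Quaternion.normSq_nonneg (a := a))
      (Ne.symm (Quaternion.normSq_ne_zero.2 ha))
    rw [Quaternion.normSq_def] at h
    exact h
  normSq_mul a b := by
    change ((a * b) * star (a * b)).re = (a * star a).re * (b * star b).re
    simp
    ring

end Octonions

/-! ## Signs, super vector spaces and Lie superalgebras -/

/-- The sign `(-1) ^ a` of a parity `a`. -/
def paritySign (a : ZMod 2) : ℤ := (-1) ^ a.val

/-- The Koszul sign `ε(σ)` of a permutation of elements of grades `d`: permuting the factors gives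
`x₁ ⋯ xₙ = ε(σ) x_{σ(1)} ⋯ x_{σ(n)}` in the free graded-commutative algebra. Every inversion
contributes the sign of one interchange. -/
def koszulSign {n : ℕ} (σ : Equiv.Perm (Fin n)) (d : Fin n → ZMod 2) : ℤ :=
  ∏ i : Fin n, ∏ j : Fin n, if i < j ∧ σ j < σ i then paritySign (d (σ i) * d (σ j)) else 1

/-- `χ(σ) = sgn(σ) ε(σ)`. -/
def chiSign {n : ℕ} (σ : Equiv.Perm (Fin n)) (d : Fin n → ZMod 2) : ℤ :=
  (Equiv.Perm.sign σ : ℤ) * koszulSign σ d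

/-- A super vector space: a real vector space with a decomposition into an even part `part 0` and
an odd part `part 1`. -/
class SuperSpace (V : Type*) [AddCommGroup V] [Module ℝ V] where
  part : ZMod 2 → Submodule ℝ V
  isCompl : IsCompl (part 0) (part 1)

/-- The real numbers as a purely even super vector space. -/
instance : SuperSpace ℝ where
  part a := if a = 0 then ⊤ else ⊥
  isCompl := by simpa using isCompl_top_bot

/-- Real Lie superalgebras. -/
class LieSuperalgebra (L : Type*) [AddCommGroup L] [Module ℝ L] [SuperSpace L] where
  bracket : L →ₗ[ℝ] L →ₗ[ℝ] L
  bracket_mem : ∀ {a b : ZMod 2} {x y : L}, x ∈ SuperSpace.part a → y ∈ SuperSpace.part b →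
    bracket x y ∈ SuperSpace.part (V := L) (a + b)
  bracket_skew : ∀ {a b : ZMod 2} {x y : L}, x ∈ SuperSpace.part a → y ∈ SuperSpace.part b →
    bracket x y = -(paritySign (a * b) • bracket y x)
  jacobi : ∀ {a b c : ZMod 2} {x y z : L}, x ∈ SuperSpace.part a → y ∈ SuperSpace.part b →
    z ∈ SuperSpace.part c →
    bracket x (bracket y z) =
      bracket (bracket x y) z + paritySign (a * b) • bracket y (bracket x z)

/-- A representation of a Lie superalgebra `L` on a super vector space `R`, that is, a homomorphism
of Lie superalgebras from `L` to `gl(R)`. -/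
structure SuperRep (L R : Type*) [AddCommGroup L] [Module ℝ L] [SuperSpace L] [LieSuperalgebra L]
    [AddCommGroup R] [Module ℝ R] [SuperSpace R] where
  act : L →ₗ[ℝ] R →ₗ[ℝ] R
  act_mem : ∀ {a b : ZMod 2} {x : L} {v : R}, x ∈ SuperSpace.part a → v ∈ SuperSpace.part b →
    act x v ∈ SuperSpace.part (V := R) (a + b)
  act_bracket : ∀ {a b : ZMod 2} {x y : L} (v : R), x ∈ SuperSpace.part a →
    y ∈ SuperSpace.part b →
    act (LieSuperalgebra.bracket x y) v = act x (act y v) - paritySign (a * b) • act y (act x v)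

/-- The trivial representation. -/
def SuperRep.trivial (L R : Type*) [AddCommGroup L] [Module ℝ L] [SuperSpace L]
    [LieSuperalgebra L] [AddCommGroup R] [Module ℝ R] [SuperSpace R] : SuperRep L R where
  act := 0
  act_mem _ _ := by simp
  act_bracket _ _ _ := by simp

/-! ## Cohomology of Lie superalgebras -/

section Cohomology

variable {L R : Type*} [AddCommGroup L] [Module ℝ L] [SuperSpace L]
  [AddCommGroup R] [Module ℝ R] [SuperSpace R]

/-- `n`-cochains are the super-skew-symmetric `n`-linear maps. -/
def IsCochain {n : ℕ} (ω : MultilinearMap ℝ (fun _ : Fin n => L) R) : Prop :=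
  ∀ (σ : Equiv.Perm (Fin n)) (a : Fin n → ZMod 2) (x : Fin n → L),
    (∀ i, x i ∈ SuperSpace.part (a i)) → ω (x ∘ σ) = chiSign σ a • ω x

/-- The multilinear map `ω` has parity `c`: it is even (parity-preserving) for `c = 0` and odd
(parity-reversing) for `c = 1`. -/
def HasParity {n : ℕ} (c : ZMod 2) (ω : MultilinearMap ℝ (fun _ : Fin n => L) R) : Prop :=
  ∀ (a : Fin n → ZMod 2) (x : Fin n → L),
    (∀ i, x i ∈ SuperSpace.part (a i)) → ω x ∈ SuperSpace.part (∑ i, a i + c)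

/-- The sign of moving the `i`-th of a sequence of elements of parities `a` to the front. -/
def frontSign {n : ℕ} (a : Fin n → ZMod 2) (i : Fin n) : ℤ :=
  paritySign (a i * ∑ k ∈ Finset.univ.filter (· < i), a k)

variable [LieSuperalgebra L]

/-- The part of `dω` that involves the bracket: the sum over `i < j` of
`(-1)^{i+j} (-1)^{|Xᵢ||Xⱼ|} ε(i) ε(j) ω([Xᵢ, Xⱼ], X₁, …, X̂ᵢ, …, X̂ⱼ, …)`. -/
def coboundaryBracketPart : {n : ℕ} → MultilinearMap ℝ (fun _ : Fin n => L) R →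
    (Fin (n + 1) → ZMod 2) → (Fin (n + 1) → L) → R
  | 0, _, _, _ => 0
  | n + 1, ω, a, X => ∑ i : Fin (n + 1), ∑ j : Fin (n + 2),
      if i.castSucc < j then
        ((-1) ^ ((i : ℕ) + (j : ℕ)) * paritySign (a i.castSucc * a j) *
            frontSign a i.castSucc * frontSign a j : ℤ) •
          ω (Fin.cons (LieSuperalgebra.bracket (X i.castSucc) (X j))
            fun k : Fin n => X (j.succAbove (i.succAbove k)))
      else 0

/-- The value `dω(X₁, …, Xₙ₊₁)` of the coboundary of a cochain `ω` of parity `c` on homogeneous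
elements `Xᵢ` of parities `aᵢ`. -/
def coboundary (ρ : SuperRep L R) {n : ℕ} (c : ZMod 2)
    (ω : MultilinearMap ℝ (fun _ : Fin n => L) R)
    (a : Fin (n + 1) → ZMod 2) (X : Fin (n + 1) → L) : R :=
  (∑ i : Fin (n + 1), ((-1) ^ (i : ℕ) * paritySign (a i * c) * frontSign a i : ℤ) •
      ρ.act (X i) (ω fun k : Fin n => X (i.succAbove k)))
    + coboundaryBracketPart ω a X

/-- Even `n`-cocycles with values in the representation `ρ`. -/
structure IsEvenCocycle (ρ : SuperRep L R) {n : ℕ}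
    (ω : MultilinearMap ℝ (fun _ : Fin n => L) R) : Prop where
  isCochain : IsCochain ω
  even : HasParity 0 ω
  closed : ∀ (a : Fin (n + 1) → ZMod 2) (X : Fin (n + 1) → L),
    (∀ i, X i ∈ SuperSpace.part (a i)) → coboundary ρ 0 ω a X = 0

/-- The `(n+1)`-cochain `ω` is trivial: it is the coboundary of an `n`-cochain, which is written as
the sum of its even part `θ₀` and its odd part `θ₁`. -/
def IsTrivialCocycle (ρ : SuperRep L R) {n : ℕ}
    (ω : MultilinearMap ℝ (fun _ : Fin (n + 1) => L) R) : Prop :=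
  ∃ θ₀ θ₁ : MultilinearMap ℝ (fun _ : Fin n => L) R,
    IsCochain θ₀ ∧ HasParity 0 θ₀ ∧ IsCochain θ₁ ∧ HasParity 1 θ₁ ∧
    ∀ (a : Fin (n + 1) → ZMod 2) (X : Fin (n + 1) → L),
      (∀ i, X i ∈ SuperSpace.part (a i)) →
        ω X = coboundary ρ 0 θ₀ a X + coboundary ρ 1 θ₁ a X

end Cohomology

/-! ## L∞-superalgebras -/

/-- `σ` is an `(i, n-i)`-unshuffle: it is increasing on the first `i` places and on the others. -/
def IsUnshuffle {n : ℕ} (i : ℕ) (σ : Equiv.Perm (Fin n)) : Prop :=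
  ∀ a b : Fin n, a < b → ((b : ℕ) < i ∨ i ≤ (a : ℕ)) → σ a < σ b

instance {n : ℕ} (i : ℕ) : DecidablePred (IsUnshuffle (n := n) i) := fun σ => by
  unfold IsUnshuffle; infer_instance

/-- An L∞-superalgebra on the total space `W` of a super chain complex. The summand `gr p a` is the
part of degree `p` and parity `a`; degrees are nonnegative. Signs are governed by the overall
grade `p + a`. The bracket `l k` is parity-preserving of degree `k - 2` (there is no `0`-ary
bracket), and `l 1` is the differential of the complex. -/
structure LInftySuperalgebra (W : Type*) [AddCommGroup W] [Module ℝ W] where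
  gr : ℤ → ZMod 2 → Submodule ℝ W
  internal : DirectSum.IsInternal fun q : ℤ × ZMod 2 => gr q.1 q.2
  gr_neg : ∀ p a, p < 0 → gr p a = ⊥
  l : ∀ k : ℕ, MultilinearMap ℝ (fun _ : Fin k => W) W
  l_zero : l 0 = 0
  l_mem : ∀ (k : ℕ) (p : Fin k → ℤ) (a : Fin k → ZMod 2) (x : Fin k → W),
    (∀ i, x i ∈ gr (p i) (a i)) → l k x ∈ gr (∑ i, p i + k - 2) (∑ i, a i)
  antisymm : ∀ (k : ℕ) (σ : Equiv.Perm (Fin k)) (p : Fin k → ℤ) (a : Fin k → ZMod 2)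
    (x : Fin k → W), (∀ i, x i ∈ gr (p i) (a i)) →
      l k (x ∘ σ) = chiSign σ (fun i => (p i : ZMod 2) + a i) • l k x
  /-- The sum over `i ≥ 1`, `i + j = n + 1`, and over all `(i, n-i)`-unshuffles `σ`, of
  `χ(σ) (-1)^{i(j-1)} l_j (l_i (x_{σ(1)}, …, x_{σ(i)}), x_{σ(i+1)}, …, x_{σ(n)})` vanishes. -/
  jacobi : ∀ (n : ℕ) (p : Fin n → ℤ) (a : Fin n → ZMod 2) (x : Fin n → W),
    (∀ i, x i ∈ gr (p i) (a i)) →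
      ∑ i : Fin (n + 1), (if (i : ℕ) = 0 then 0 else
        ∑ σ ∈ Finset.univ.filter (IsUnshuffle (n := n) i),
          (chiSign σ (fun m => (p m : ZMod 2) + a m) * (-1) ^ ((i : ℕ) * (n - (i : ℕ))) : ℤ) •
            l (n - (i : ℕ) + 1)
              (Fin.cons (l i fun m : Fin (i : ℕ) => x (σ ⟨m, by omega⟩))
                fun m : Fin (n - (i : ℕ)) => x (σ ⟨(i : ℕ) + m, by omega⟩))) = 0

namespace LInftySuperalgebra

/-- The grading of a super vector space placed in degree `n`. -/
def singleGrading (V : Type*) [AddCommGroup V] [Module ℝ V] [SuperSpace V] (n : ℕ)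
    (p : ℤ) (a : ZMod 2) : Submodule ℝ V :=
  if p = n then SuperSpace.part a else ⊥

theorem singleGrading_isInternal (V : Type*) [AddCommGroup V] [Module ℝ V] [SuperSpace V]
    (n : ℕ) :
    DirectSum.IsInternal fun q : ℤ × ZMod 2 => singleGrading V n q.1 q.2 := by
  have hdis : ∀ a : ZMod 2, Disjoint (SuperSpace.part (V := V) a) (SuperSpace.part (a + 1)) := by
    intro a
    fin_cases a
    · exact SuperSpace.isCompl.disjoint
    · exact SuperSpace.isCompl.disjoint.symm
  have hne : ∀ a b : ZMod 2, b ≠ a → b = a + 1 := by decide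
  rw [DirectSum.isInternal_submodule_iff_iSupIndep_and_iSup_eq_top]
  constructor
  · rintro ⟨p, a⟩
    by_cases hp : p = n
    · refine Disjoint.mono (le_of_eq ?_) ?_ (hdis a)
      · simp [singleGrading, hp]
      · refine iSup₂_le ?_
        rintro ⟨q, b⟩ hq
        by_cases hqn : q = n
        · have hb : b ≠ a := fun h => hq (by rw [hqn, hp, h])
          simp [singleGrading, hqn, hne a b hb]
        · simp [singleGrading, hqn]
    · simp [singleGrading, hp]
  · rw [eq_top_iff, ← (SuperSpace.isCompl (V := V)).sup_eq_top]
    refine sup_le ?_ ?_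
    · refine le_trans (le_of_eq ?_)
        (le_iSup (fun q : ℤ × ZMod 2 => singleGrading V n q.1 q.2) ((n : ℤ), 0))
      simp [singleGrading]
    · refine le_trans (le_of_eq ?_)
        (le_iSup (fun q : ℤ × ZMod 2 => singleGrading V n q.1 q.2) ((n : ℤ), 1))
      simp [singleGrading]

/-- The abelian L∞-superalgebra `bⁿR`, with `R` in degree `n` and zero in the other degrees. -/
def abelian (R : Type*) [AddCommGroup R] [Module ℝ R] [SuperSpace R] (n : ℕ) :
    LInftySuperalgebra R where
  gr := singleGrading R n
  internal := singleGrading_isInternal R n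
  gr_neg p a hp := by
    have : p ≠ n := by omega
    simp [singleGrading, this]
  l _ := 0
  l_zero := rfl
  l_mem _ _ _ _ _ := by simp
  antisymm _ _ _ _ _ _ := by simp
  jacobi _ _ _ _ _ := by simp

/-- The bracket of a Lie superalgebra as a map on pairs. -/
def lieBracketTwo (L : Type*) [AddCommGroup L] [Module ℝ L] [SuperSpace L] [LieSuperalgebra L] :
    MultilinearMap ℝ (fun _ : Fin 2 => L) L where
  toFun x := LieSuperalgebra.bracket (x 0) (x 1)
  map_update_add' := by
    intro inst x i u v
    rw [Subsingleton.elim inst (instDecidableEqFin 2)]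
    fin_cases i <;> simp
  map_update_smul' := by
    intro inst x i c u
    rw [Subsingleton.elim inst (instDecidableEqFin 2)]
    fin_cases i <;> simp

/-- The brackets of a Lie superalgebra regarded as an L∞-superalgebra: `l 2` is the Lie bracket,
and the others vanish. -/
def lieBrackets (L : Type*) [AddCommGroup L] [Module ℝ L] [SuperSpace L] [LieSuperalgebra L] :
    ∀ k : ℕ, MultilinearMap ℝ (fun _ : Fin k => L) L
  | 2 => lieBracketTwo L
  | _ => 0

theorem lieBrackets_ne (L : Type*) [AddCommGroup L] [Module ℝ L] [SuperSpace L]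
    [LieSuperalgebra L] {k : ℕ} (hk : k ≠ 2) : lieBrackets L k = 0 := by
  unfold lieBrackets
  split
  · exact absurd rfl hk
  · rfl

theorem lieBrackets_jacobi (L : Type*) [AddCommGroup L] [Module ℝ L] [SuperSpace L]
    [LieSuperalgebra L] (a : Fin 3 → ZMod 2) (x : Fin 3 → L)
    (hx : ∀ i, x i ∈ SuperSpace.part (a i)) :
    ∑ σ ∈ Finset.univ.filter (IsUnshuffle (n := 3) 2),
      chiSign σ a • LieSuperalgebra.bracket
        (LieSuperalgebra.bracket (x (σ 0)) (x (σ 1))) (x (σ 2)) = 0 := by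
  have hf : Finset.univ.filter (IsUnshuffle (n := 3) 2) =
      {1, Equiv.swap 1 2, finRotate 3} := by decide
  have h1 : ∀ a : Fin 3 → ZMod 2, chiSign (1 : Equiv.Perm (Fin 3)) a = 1 := by decide
  have h2 : ∀ a : Fin 3 → ZMod 2,
      chiSign (Equiv.swap 1 2 : Equiv.Perm (Fin 3)) a = - paritySign (a 1 * a 2) := by decide
  have h3 : ∀ a : Fin 3 → ZMod 2,
      chiSign (finRotate 3) a = paritySign (a 0 * a 1) * paritySign (a 0 * a 2) := by decide
  have e1 : finRotate 3 0 = 1 := by decide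
  have e2 : finRotate 3 1 = 2 := by decide
  have e3 : finRotate 3 2 = 0 := by decide
  have e4 : (Equiv.swap 1 2 : Equiv.Perm (Fin 3)) 0 = 0 := by decide
  have n1 : (1 : Equiv.Perm (Fin 3)) ≠ Equiv.swap 1 2 := by decide
  have n2 : (1 : Equiv.Perm (Fin 3)) ≠ finRotate 3 := by decide
  have n3 : (Equiv.swap 1 2 : Equiv.Perm (Fin 3)) ≠ finRotate 3 := by decide
  rw [hf, Finset.sum_insert (by simp [n1, n2]), Finset.sum_insert (by simp [n3]),
    Finset.sum_singleton, h1, h2, h3, e1, e2, e3, e4]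
  simp only [Equiv.Perm.one_apply, Equiv.swap_apply_left, Equiv.swap_apply_right]
  have j := LieSuperalgebra.jacobi (hx 0) (hx 1) (hx 2)
  have s1 := LieSuperalgebra.bracket_skew (hx 0)
    (LieSuperalgebra.bracket_mem (hx 1) (hx 2))
  have s2 := LieSuperalgebra.bracket_skew (hx 1)
    (LieSuperalgebra.bracket_mem (hx 0) (hx 2))
  have s : ∀ u v w : ZMod 2, paritySign (u * (v + w)) = paritySign (u * v) * paritySign (u * w) := by
    decide
  have q : ∀ u v : ZMod 2, paritySign (u * v) * paritySign (v * u) = 1 := by decide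
  rw [s1, s2, s, s, smul_neg, smul_smul, ← mul_assoc, q, one_mul] at j
  simp only [neg_smul, one_smul] at j ⊢
  have j' := eq_neg_of_add_eq_zero_left (neg_eq_iff_add_eq_zero.1 j)
  rw [j']
  abel

/-- A Lie superalgebra as an L∞-superalgebra concentrated in degree `0`. -/
def ofLie (L : Type*) [AddCommGroup L] [Module ℝ L] [SuperSpace L] [LieSuperalgebra L] :
    LInftySuperalgebra L where
  gr := singleGrading L 0
  internal := singleGrading_isInternal L 0
  gr_neg p a hp := by
    have : p ≠ 0 := by omega
    simp [singleGrading, this]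
  l := lieBrackets L
  l_zero := rfl
  l_mem k p a x hx := by
    by_cases hk : k = 2
    · subst hk
      by_cases hp : ∀ i, p i = 0
      · have h0 := hx 0
        have h1 := hx 1
        simp only [singleGrading, hp, Nat.cast_zero, if_true] at h0 h1
        have := LieSuperalgebra.bracket_mem h0 h1
        simpa [singleGrading, hp, lieBrackets, lieBracketTwo, Fin.sum_univ_two] using this
      · push Not at hp
        obtain ⟨i, hi⟩ := hp
        have h0 : x i = 0 := by simpa [singleGrading, hi] using hx i
        rw [MultilinearMap.map_coord_zero _ i h0]
        exact Submodule.zero_mem _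
    · simp [lieBrackets_ne L hk]
  antisymm k σ p a x hx := by
    by_cases hk : k = 2
    · subst hk
      by_cases hp : ∀ i, p i = 0
      · have h0 := hx 0
        have h1 := hx 1
        simp only [singleGrading, hp, Nat.cast_zero, if_true] at h0 h1
        have hs := LieSuperalgebra.bracket_skew h1 h0
        have hσ : σ = 1 ∨ σ = Equiv.swap 0 1 := by revert σ; decide
        have c1 : ∀ a : Fin 2 → ZMod 2, chiSign (1 : Equiv.Perm (Fin 2)) a = 1 := by decide
        have c2 : ∀ a : Fin 2 → ZMod 2,
            chiSign (Equiv.swap 0 1 : Equiv.Perm (Fin 2)) a = - paritySign (a 1 * a 0) := by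
          decide
        rcases hσ with rfl | rfl
        · rw [c1, one_smul]; rfl
        · rw [c2]
          simpa [hp, lieBrackets, lieBracketTwo] using hs
      · push Not at hp
        obtain ⟨i, hi⟩ := hp
        have h0 : x i = 0 := by simpa [singleGrading, hi] using hx i
        rw [MultilinearMap.map_coord_zero _ i h0,
          MultilinearMap.map_coord_zero _ (σ.symm i) (by simpa using h0), smul_zero]
    · simp [lieBrackets_ne L hk]
  jacobi n p a x hx := by
    by_cases hp : ∀ i, p i = 0
    · refine Finset.sum_eq_zero fun i _ => ?_
      by_cases hi : (i : ℕ) = 2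
      · by_cases hn : n = 3
        · subst hn
          obtain rfl : i = 2 := Fin.ext hi
          have hx' : ∀ i, x i ∈ SuperSpace.part (a i) := fun i => by
            simpa [singleGrading, hp] using hx i
          have := lieBrackets_jacobi L a x hx'
          simp only [hp, Int.cast_zero, zero_add]
          rw [if_neg (by simp)]
          refine Eq.trans (Finset.sum_congr rfl fun σ _ => ?_) this
          change (chiSign σ a * 1 : ℤ) • _ = _
          rw [mul_one]
          rfl
        · rw [if_neg (by omega)]
          refine Finset.sum_eq_zero fun σ _ => ?_
          rw [lieBrackets_ne L (k := n - (i : ℕ) + 1) (by omega)]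
          simp
      · split_ifs
        · rfl
        · refine Finset.sum_eq_zero fun σ _ => ?_
          rw [MultilinearMap.map_coord_zero _ 0, smul_zero]
          rw [Fin.cons_zero, lieBrackets_ne L hi]
          rfl
    · push Not at hp
      obtain ⟨m, hm⟩ := hp
      have h0 : x m = 0 := by simpa [singleGrading, hm] using hx m
      refine Finset.sum_eq_zero fun i _ => ?_
      split_ifs
      · rfl
      · refine Finset.sum_eq_zero fun σ _ => ?_
        by_cases hmi : (σ.symm m : ℕ) < i
        · rw [MultilinearMap.map_coord_zero _ 0, smul_zero]
          rw [Fin.cons_zero]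
          refine MultilinearMap.map_coord_zero _ ⟨(σ.symm m : ℕ), hmi⟩ ?_
          simpa using h0
        · rw [MultilinearMap.map_coord_zero _
            (Fin.succ ⟨(σ.symm m : ℕ) - i, by omega⟩), smul_zero]
          rw [Fin.cons_succ]
          have e : (⟨(i : ℕ) + ((σ.symm m : ℕ) - i), by omega⟩ : Fin n) = σ.symm m :=
            Fin.ext (by simp; omega)
          rw [e]
          simpa using h0

/-- Strict morphisms: degree- and parity-preserving linear maps that commute with all brackets. -/
structure Hom {W W' : Type*} [AddCommGroup W] [Module ℝ W] [AddCommGroup W'] [Module ℝ W']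
    (A : LInftySuperalgebra W) (B : LInftySuperalgebra W') where
  toLin : W →ₗ[ℝ] W'
  map_gr : ∀ (p : ℤ) (a : ZMod 2) (x : W), x ∈ A.gr p a → toLin x ∈ B.gr p a
  map_l : ∀ (k : ℕ) (x : Fin k → W), toLin (A.l k x) = B.l k fun i => toLin (x i)

section

variable {W : Type*} [AddCommGroup W] [Module ℝ W]

/-- `A` is a Lie `n`-superalgebra: its nonzero terms all have degree `< n`. -/
def IsLie (A : LInftySuperalgebra W) (n : ℕ) : Prop :=
  ∀ (p : ℤ) (a : ZMod 2), (n : ℤ) ≤ p → A.gr p a = ⊥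

/-- `A` is an extension of the Lie superalgebra `g` by `bⁿR`: there is a short exact sequence
`0 → bⁿR → A → g → 0` of L∞-superalgebras. -/
def IsExtension (A : LInftySuperalgebra W) (g R : Type*) [AddCommGroup g] [Module ℝ g]
    [SuperSpace g] [LieSuperalgebra g] [AddCommGroup R] [Module ℝ R] [SuperSpace R]
    (n : ℕ) : Prop :=
  ∃ (ι : Hom (abelian R n) A) (π : Hom A (ofLie g)),
    Function.Injective ι.toLin ∧ Function.Exact ι.toLin π.toLin ∧ Function.Surjective π.toLin

/-- `A` corresponds to the quadruple `(g, R, ρ, ω)`, where `g` is a Lie superalgebra, `ρ` a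
representation of `g` on the super vector space `R` and `ω` an even `(n+2)`-cocycle on `g` with
values in `R`: the only nonzero terms of `A` are `A₀ ≅ g` and `Aₙ ≅ R`, the differential vanishes,
the bracket of `A` restricts to the bracket of `g` and to `ρ`, and `l (n + 2)` restricts to `ω`. -/
def CorrespondsTo (A : LInftySuperalgebra W) {g R : Type*} [AddCommGroup g] [Module ℝ g]
    [SuperSpace g] [LieSuperalgebra g] [AddCommGroup R] [Module ℝ R] [SuperSpace R] {n : ℕ}
    (ρ : SuperRep g R) (ω : MultilinearMap ℝ (fun _ : Fin (n + 2) => g) R) : Prop :=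
  0 < n ∧ IsEvenCocycle ρ ω ∧
  (∀ (p : ℤ) (a : ZMod 2), p ≠ 0 → p ≠ n → A.gr p a = ⊥) ∧ A.l 1 = 0 ∧
  ∃ (e₀ : g →ₗ[ℝ] W) (e₁ : R →ₗ[ℝ] W),
    Function.Injective e₀ ∧ Function.Injective e₁ ∧
    (∀ a, (SuperSpace.part a).map e₀ = A.gr 0 a) ∧
    (∀ a, (SuperSpace.part a).map e₁ = A.gr n a) ∧
    (∀ x y : g, A.l 2 ![e₀ x, e₀ y] = e₀ (LieSuperalgebra.bracket x y)) ∧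
    (∀ (x : g) (v : R), A.l 2 ![e₀ x, e₁ v] = e₁ (ρ.act x v)) ∧
    (∀ x : Fin (n + 2) → g, A.l (n + 2) (fun i => e₀ (x i)) = e₁ (ω x))

end

/-- The Lie `(n+1)`-superalgebra `A` is exact: it corresponds to a quadruple `(g, R, ρ, ω)`, so that
only its terms of degree `0` and `n` are nonzero, and the `(n+2)`-cocycle `ω` is trivial. -/
def IsExact.{u} {W : Type u} [AddCommGroup W] [Module ℝ W] (A : LInftySuperalgebra W) (n : ℕ) :
    Prop :=
  A.IsLie (n + 1) ∧
  ∃ (g R : Type u) (_ : AddCommGroup g) (_ : Module ℝ g) (_ : SuperSpace g)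
    (_ : LieSuperalgebra g) (_ : AddCommGroup R) (_ : Module ℝ R) (_ : SuperSpace R)
    (ρ : SuperRep g R) (ω : MultilinearMap ℝ (fun _ : Fin (n + 2) => g) R),
    A.CorrespondsTo ρ ω ∧ IsTrivialCocycle ρ ω

end LInftySuperalgebra

/-! ## Vectors, spinors and the supertranslation algebra -/

noncomputable section Spacetime

variable (K : Type*) [NonAssocRing K] [StarRing K] [Module ℝ K] [NormedDivisionAlgebra K]

/-- The vectors: the hermitian `2 × 2` matrices with entries in `K`. -/
def Vec : Submodule ℝ (Matrix (Fin 2) (Fin 2) K) where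
  carrier := {A | A.conjTranspose = A}
  add_mem' {A B} hA hB := by
    simp only [Set.mem_ofPred_eq] at *
    rw [Matrix.conjTranspose_add, hA, hB]
  zero_mem' := by simp
  smul_mem' r A hA := by
    simp only [Set.mem_ofPred_eq] at *
    rw [Matrix.conjTranspose_smul, hA, star_trivial]

/-- The spinors `S₊ = K²`. -/
abbrev Spinor : Type _ := Fin 2 → K

variable {K}

/-- The real part. -/
def divRe : K →ₗ[ℝ] ℝ := NormedDivisionAlgebra.re

/-- The Minkowski metric `g`: the bilinear form obtained by polarizing
`g(A, A) = -det A = -(A₀₀ A₁₁ - |A₀₁|²)`. -/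
def minkowski : Vec K →ₗ[ℝ] Vec K →ₗ[ℝ] ℝ :=
  LinearMap.mk₂ ℝ
    (fun A B => divRe (A.1 0 1 * star (B.1 0 1)) -
      (divRe (A.1 0 0) * divRe (B.1 1 1) + divRe (A.1 1 1) * divRe (B.1 0 0)) / 2)
    (fun A A' B => by simp [add_mul]; ring)
    (fun c A B => by simp [smul_mul_assoc]; ring)
    (fun A B B' => by simp [mul_add]; ring)
    (fun c A B => by simp [mul_smul_comm]; ring)

/-- The trace reversal `A - (tr A) 1`. -/
def traceReversal : Vec K →ₗ[ℝ] Vec K where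
  toFun A := ⟨A.1 - Matrix.diagonal fun _ => A.1.trace, by
    have hA : A.1.conjTranspose = A.1 := A.2
    change Matrix.conjTranspose _ = _
    rw [Matrix.conjTranspose_sub, Matrix.diagonal_conjTranspose, hA]
    congr 2
    funext _
    change star A.1.trace = A.1.trace
    rw [← Matrix.trace_conjTranspose, hA]⟩
  map_add' A B := by
    apply Subtype.ext
    ext i j
    by_cases h : i = j <;> simp [h, Matrix.trace_add] <;> abel
  map_smul' c A := by
    apply Subtype.ext
    ext i j
    by_cases h : i = j <;> simp [h, Matrix.trace_smul, smul_sub]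

/-- The hermitian matrix `ψ φ† + φ ψ†`. -/
def spinorOuter : Spinor K →ₗ[ℝ] Spinor K →ₗ[ℝ] Vec K :=
  LinearMap.mk₂ ℝ
    (fun ψ φ => ⟨Matrix.vecMulVec ψ (star φ) + Matrix.vecMulVec φ (star ψ), by
      change Matrix.conjTranspose _ = _
      ext i j
      simp [Matrix.vecMulVec, add_comm]⟩)
    (fun ψ ψ' φ => by
      apply Subtype.ext; ext i j; simp [Matrix.vecMulVec, add_mul, mul_add]; abel)
    (fun c ψ φ => by
      apply Subtype.ext; ext i j
      simp [Matrix.vecMulVec, smul_mul_assoc, mul_smul_comm])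
    (fun ψ φ φ' => by
      apply Subtype.ext; ext i j; simp [Matrix.vecMulVec, add_mul, mul_add]; abel)
    (fun c ψ φ => by
      apply Subtype.ext; ext i j
      simp [Matrix.vecMulVec, smul_mul_assoc, mul_smul_comm])

/-- The bracket of spinors `ψ · φ`, the trace reversal of `ψ φ† + φ ψ†`. -/
def spinorBracket : Spinor K →ₗ[ℝ] Spinor K →ₗ[ℝ] Vec K :=
  spinorOuter.compr₂ traceReversal

theorem spinorBracket_comm (ψ φ : Spinor K) : spinorBracket ψ φ = spinorBracket φ ψ := by
  have : spinorOuter ψ φ = spinorOuter φ ψ := by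
    apply Subtype.ext
    simp [spinorOuter, add_comm]
  simp [spinorBracket, this]

theorem divRe_star (a : K) : divRe (star a) = divRe a := by
  have h1 := NormedDivisionAlgebra.add_star_eq a
  have h2 := NormedDivisionAlgebra.add_star_eq (star a)
  rw [star_star, add_comm, h1] at h2
  have := smul_left_injective ℝ (one_ne_zero (α := K)) h2
  simp only [divRe]
  linarith

theorem eq_divRe_smul_one {a : K} (h : star a = a) : a = divRe a • (1 : K) := by
  have h1 := NormedDivisionAlgebra.add_star_eq a
  rw [h, ← two_smul ℝ a, mul_smul] at h1
  exact smul_right_injective K (two_ne_zero (α := ℝ)) h1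

theorem minkowski_self (A : Vec K) :
    minkowski A A = -(divRe (A.1 0 0) * divRe (A.1 1 1) - divRe (A.1 0 1 * star (A.1 0 1))) := by
  simp [minkowski]; ring

theorem divRe_mul_star_comm (a b : K) : divRe (a * star b) = divRe (b * star a) := by
  rw [← divRe_star, star_mul, star_star]

theorem divRe_mul_comm (a b : K) : divRe (a * b) = divRe (b * a) := by
  have hb : star b = (2 * divRe b) • (1 : K) - b :=
    eq_sub_of_add_eq' (NormedDivisionAlgebra.add_star_eq b)
  have ha : star a = (2 * divRe a) • (1 : K) - a :=
    eq_sub_of_add_eq' (NormedDivisionAlgebra.add_star_eq a)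
  have h := divRe_mul_star_comm a b
  rw [ha, hb] at h
  simp only [mul_sub, mul_smul_comm, mul_one, map_sub, map_smul, smul_eq_mul] at h
  linarith

theorem divRe_mul_star_left (a b d : K) :
    divRe ((a * b) * star d) = divRe (b * star (star a * d)) := by
  have N := NormedDivisionAlgebra.normSq_mul (K := K)
  change ∀ a b : K, divRe ((a * b) * star (a * b)) = divRe (a * star a) * divRe (b * star b) at N
  have ha : star a = (2 * divRe a) • (1 : K) - a :=
    eq_sub_of_add_eq' (NormedDivisionAlgebra.add_star_eq a)
  have h1 := N (a + 1) (b + d)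
  have h2 := N (a + 1) b
  have h3 := N (a + 1) d
  have h4 := N a (b + d)
  have h5 := N a b
  have h6 := N a d
  have r1 : divRe (1 : K) = 1 := by
    have h := NormedDivisionAlgebra.add_star_eq (1 : K)
    rw [star_one, ← two_smul ℝ (1 : K)] at h
    have := smul_left_injective ℝ (one_ne_zero (α := K)) h
    simp only [divRe]
    linarith
  have ra := divRe_star a
  have c1 := divRe_mul_star_comm (a * b) d
  have c2 := divRe_mul_star_comm (a * d) b
  have c3 := divRe_mul_star_comm (a * b) (a * d)
  have c4 := divRe_mul_star_comm b d
  have c5 := divRe_mul_star_comm (a * b) b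
  have c6 := divRe_mul_star_comm (a * d) d
  have e : divRe (b * star (star a * d)) =
      2 * divRe a * divRe (b * star d) - divRe (b * star (a * d)) := by
    rw [ha, sub_mul, smul_mul_assoc, one_mul, star_sub, star_smul, mul_sub, map_sub,
      mul_smul_comm, map_smul]
    simp
  rw [e]
  simp only [add_mul, mul_add, one_mul, mul_one, star_add, star_one, map_add, ra, r1, ← c1, ← c2,
    ← c4, ← c5, ← c6] at h1 h2 h3 h4
  linarith

theorem divRe_mul_assoc (a b c : K) : divRe ((a * b) * c) = divRe (a * (b * c)) := by
  have key : ∀ a b c : K, divRe ((a * b) * c) = divRe ((c * a) * b) := by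
    intro a b c
    have h := divRe_mul_star_left a b (star c)
    rw [star_star, star_mul, star_star, star_star] at h
    rw [h, divRe_mul_comm]
  rw [key, key, divRe_mul_comm]

/-- The defining property of the bracket of spinors: `g(ψ · φ, A) = Re(ψ† (A φ))`. -/
theorem minkowski_spinorBracket (ψ φ : Spinor K) (A : Vec K) :
    minkowski (spinorBracket ψ φ) A = divRe (star ψ ⬝ᵥ A.1.mulVec φ) := by
  have hA : A.1.conjTranspose = A.1 := A.2
  have h10 : A.1 1 0 = star (A.1 0 1) := by
    conv_lhs => rw [← hA]
    rfl
  have h00 : A.1 0 0 = divRe (A.1 0 0) • (1 : K) := eq_divRe_smul_one (by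
    conv_rhs => rw [← hA]
    rfl)
  have h11 : A.1 1 1 = divRe (A.1 1 1) • (1 : K) := eq_divRe_smul_one (by
    conv_rhs => rw [← hA]
    rfl)
  have c : ∀ a b : K, divRe (a * star b) = divRe (star b * a) := fun a b => divRe_mul_comm _ _
  have t1 : divRe ((ψ 0 * star (φ 1)) * star (A.1 0 1)) =
      divRe (star (ψ 0) * (A.1 0 1 * φ 1)) := by
    rw [← divRe_star, star_mul, star_mul, star_star, star_star, ← divRe_mul_assoc, c]
  have t2 : divRe ((φ 0 * star (ψ 1)) * star (A.1 0 1)) =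
      divRe (star (ψ 1) * (star (A.1 0 1) * φ 0)) := by
    rw [divRe_mul_assoc, divRe_mul_comm, divRe_mul_assoc]
  have u0 := divRe_mul_star_comm (ψ 0) (φ 0)
  have u1 := divRe_mul_star_comm (ψ 1) (φ 1)
  have v0 := c (φ 0) (ψ 0)
  have v1 := c (φ 1) (ψ 1)
  simp only [Matrix.mulVec, dotProduct, Fin.sum_univ_two, h10, Pi.star_apply, map_add, mul_add]
  rw [← t1, ← t2]
  conv_rhs => rw [h00, h11]
  simp [minkowski, spinorBracket, spinorOuter, traceReversal, Matrix.vecMulVec,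
    Matrix.trace_fin_two, add_mul, smul_mul_assoc, mul_smul_comm]
  rw [u0, u1, v0, v1]
  ring

variable (K)

/-- The supertranslation algebra `T = V ⊕ S₊`. -/
abbrev SuperTranslation : Type _ := Vec K × Spinor K

/-- The vectors are even and the spinors are odd. -/
instance : SuperSpace (SuperTranslation K) where
  part a := if a = 0 then LinearMap.range (LinearMap.inl ℝ (Vec K) (Spinor K))
    else LinearMap.range (LinearMap.inr ℝ (Vec K) (Spinor K))
  isCompl := by simpa using LinearMap.isCompl_range_inl_inr

/-- `[(A, ψ), (B, φ)] = ψ · φ`. -/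
instance : LieSuperalgebra (SuperTranslation K) where
  bracket := (spinorBracket.compr₂ (LinearMap.inl ℝ (Vec K) (Spinor K))).compl₁₂
    (LinearMap.snd ℝ (Vec K) (Spinor K)) (LinearMap.snd ℝ (Vec K) (Spinor K))
  bracket_mem {a b x y} hx hy := by
    have hz : ∀ c : ZMod 2, c = 0 ∨ c = 1 := by decide
    obtain rfl | rfl : a = 0 ∨ a = 1 := hz a
    · obtain ⟨A, rfl⟩ := hx
      simp
    · obtain rfl | rfl : b = 0 ∨ b = 1 := hz b
      · obtain ⟨B, rfl⟩ := hy
        have : (0 : SuperTranslation K) ∈ SuperSpace.part (V := SuperTranslation K) (1 + 0) :=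
          Submodule.zero_mem _
        convert this using 1
        simp
      · exact ⟨_, rfl⟩
  bracket_skew {a b x y} hx hy := by
    have hz : ∀ c : ZMod 2, c = 0 ∨ c = 1 := by decide
    obtain rfl | rfl : a = 0 ∨ a = 1 := hz a
    · obtain ⟨A, rfl⟩ := hx
      simp
      rfl
    · obtain rfl | rfl : b = 0 ∨ b = 1 := hz b
      · obtain ⟨B, rfl⟩ := hy
        simp
      · have h : paritySign (1 * 1) = -1 := by decide
        rw [h]
        simp [spinorBracket_comm x.2 y.2]
  jacobi _ _ _ := by simp

variable {K}

/-- The `3`-cochain `α` on `T`: the unique super-skew-symmetric trilinear form with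
`α(ψ, φ, A) = g(ψ · φ, A)` that vanishes on homogeneous arguments unless one of them is a vector
and the other two are spinors. -/
def stringCocycle : MultilinearMap ℝ (fun _ : Fin 3 => SuperTranslation K) ℝ where
  toFun X := minkowski (spinorBracket (X 0).2 (X 1).2) (X 2).1 -
    minkowski (spinorBracket (X 0).2 (X 2).2) (X 1).1 +
    minkowski (spinorBracket (X 1).2 (X 2).2) (X 0).1
  map_update_add' := by
    intro inst x i u v
    have e : ∀ (k m : Fin 3) (w : SuperTranslation K), m ≠ k → Function.update x k w m = x m :=
      fun k m w h => Function.update_of_ne h w x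
    have e01 := fun w => e 0 1 w (by omega)
    have e02 := fun w => e 0 2 w (by omega)
    have e10 := fun w => e 1 0 w (by omega)
    have e12 := fun w => e 1 2 w (by omega)
    have e20 := fun w => e 2 0 w (by omega)
    have e21 := fun w => e 2 1 w (by omega)
    obtain rfl | rfl | rfl : i = 0 ∨ i = 1 ∨ i = 2 := by omega
    all_goals
      simp only [Function.update_self, e01, e02, e10, e12, e20, e21, Prod.fst_add, Prod.snd_add, Prod.smul_fst, Prod.smul_snd,
        map_add, map_smul, LinearMap.add_apply, LinearMap.smul_apply, smul_eq_mul]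
      ring
  map_update_smul' := by
    intro inst x i c u
    have e : ∀ (k m : Fin 3) (w : SuperTranslation K), m ≠ k → Function.update x k w m = x m :=
      fun k m w h => Function.update_of_ne h w x
    have e01 := fun w => e 0 1 w (by omega)
    have e02 := fun w => e 0 2 w (by omega)
    have e10 := fun w => e 1 0 w (by omega)
    have e12 := fun w => e 1 2 w (by omega)
    have e20 := fun w => e 2 0 w (by omega)
    have e21 := fun w => e 2 1 w (by omega)
    obtain rfl | rfl | rfl : i = 0 ∨ i = 1 ∨ i = 2 := by omega
    all_goals
      simp only [Function.update_self, e01, e02, e10, e12, e20, e21, Prod.fst_add, Prod.snd_add, Prod.smul_fst, Prod.smul_snd,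
        map_add, map_smul, LinearMap.add_apply, LinearMap.smul_apply, smul_eq_mul]
      ring

theorem stringCocycle_spinor_spinor_vector (ψ φ : Spinor K) (A : Vec K) :
    stringCocycle ![((0, ψ) : SuperTranslation K), (0, φ), (A, 0)] =
      minkowski (spinorBracket ψ φ) A := by
  simp [stringCocycle]

end Spacetime

/-! Any even 3-cocycle `ω` on a Lie superalgebra `L` with values in a trivial module `R` makes `L ⊕
R` (degrees 0 and 1) a Lie 2-superalgebra with `l 2` the Lie bracket and `l 3 = ω`. All brackets
depend only on the `L`-components of their arguments, so the generalized Jacobi identities split: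
the `L`-component is the Jacobi identity of `L`, and the `R`-component involves only `l 3 ∘ l 2` on
four arguments, which is `-dω` written over unshuffles (`sum_unshuffle_bracket_eq_zero`).

The form `α` is closed because `ψ · ψ` is null: up to a factor, `det (ψψ†) = |ψ₀|²|ψ₁|² - |ψ₀ψ₁*|²`,
which vanishes by multiplicativity of the norm. Polarizing this quartic identity gives a cyclic
identity in four spinors (`minkowski_spinorBracket_cyclic`), and `dα` on four spinors is minus twice
that sum.

Non-exactness is detected by one triple. For odd `ψ`, `φ` and `A = ψ · φ`, the only bracket among
the three that can be nonzero is `[ψ, φ] = A`. Hence a coboundary `dθ(ψ, φ, A)` is a multiple of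
`θ(A, A)`, which is zero as `A` is even, whereas `α(ψ, φ, A) = g(ψ · φ, ψ · φ)` is nonzero for the
two standard basis spinors. A quadruple corresponding to the same algebra contains a copy of this
triple, and its action is also trivial, so no choice of quadruple escapes the obstruction. -/

theorem Submodule.isInternal_prod {ι M N : Type*} [DecidableEq ι] [AddCommGroup M] [Module ℝ M]
    [AddCommGroup N] [Module ℝ N] {A : ι → Submodule ℝ M} {B : ι → Submodule ℝ N}
    (hA : DirectSum.IsInternal A) (hB : DirectSum.IsInternal B) :
    DirectSum.IsInternal fun i => (A i).prod (B i) := by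
  rw [DirectSum.isInternal_submodule_iff_iSupIndep_and_iSup_eq_top] at *
  constructor
  · intro i
    -- The sum of the products lies in the product of the sums, where disjointness can be tested one
    -- component at a time.
    have h : (⨆ (j) (_ : j ≠ i), (A j).prod (B j)) ≤
        (⨆ (j) (_ : j ≠ i), A j).prod (⨆ (j) (_ : j ≠ i), B j) :=
      iSup₂_le fun j hj => Submodule.prod_mono (le_iSup₂_of_le j hj le_rfl)
        (le_iSup₂_of_le j hj le_rfl)
    refine Disjoint.mono_right h (Submodule.disjoint_def.2 fun x hx hx' => ?_)
    exact Prod.ext (Submodule.disjoint_def.1 (hA.1 i) _ hx.1 hx'.1)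
      (Submodule.disjoint_def.1 (hB.1 i) _ hx.2 hx'.2)
  · rw [eq_top_iff, ← LinearMap.sup_range_inl_inr, LinearMap.range_eq_map, LinearMap.range_eq_map,
      ← hA.2, ← hB.2, Submodule.map_iSup, Submodule.map_iSup]
    refine sup_le (iSup_mono fun i => ?_) (iSup_mono fun i => ?_)
    · rintro _ ⟨x, hx, rfl⟩
      exact ⟨hx, Submodule.zero_mem _⟩
    · rintro _ ⟨x, hx, rfl⟩
      exact ⟨Submodule.zero_mem _, hx⟩

/-! ### The Lie 2-superalgebra of a 3-cocycle with trivial coefficients -/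

namespace LInftySuperalgebra

theorem eq_zero_of_mem_singleGrading {V : Type*} [AddCommGroup V] [Module ℝ V] [SuperSpace V]
    {n : ℕ} {p : ℤ} {a : ZMod 2} {x : V} (hp : p ≠ n) (hx : x ∈ singleGrading V n p a) :
    x = 0 := by
  simpa [singleGrading, hp] using hx

theorem singleGrading_of_ne {V : Type*} [AddCommGroup V] [Module ℝ V] [SuperSpace V]
    {n : ℕ} {p : ℤ} (hp : p ≠ n) (a : ZMod 2) : singleGrading V n p a = ⊥ := by
  simp [singleGrading, hp]

section OfCocycle

variable {L R : Type*} [AddCommGroup L] [Module ℝ L] [AddCommGroup R] [Module ℝ R]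

/-- The family of brackets whose only nonzero member is the ternary bracket `ω`. -/
def ternaryBrackets (ω : MultilinearMap ℝ (fun _ : Fin 3 => L) R) :
    ∀ k : ℕ, MultilinearMap ℝ (fun _ : Fin k => L) R
  | 3 => ω
  | _ => 0

theorem ternaryBrackets_ne (ω : MultilinearMap ℝ (fun _ : Fin 3 => L) R) {k : ℕ} (hk : k ≠ 3) :
    ternaryBrackets ω k = 0 := by
  unfold ternaryBrackets
  split
  · exact absurd rfl hk
  · rfl

variable [SuperSpace L] [LieSuperalgebra L]

/-- The brackets on `L × R` given by the Lie bracket of `L` and the ternary bracket `ω`. -/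
def cocycleBrackets (ω : MultilinearMap ℝ (fun _ : Fin 3 => L) R) (k : ℕ) :
    MultilinearMap ℝ (fun _ : Fin k => L × R) (L × R) :=
  ((lieBrackets L k).compLinearMap fun _ => LinearMap.fst ℝ L R).prod
    ((ternaryBrackets ω k).compLinearMap fun _ => LinearMap.fst ℝ L R)

theorem cocycleBrackets_apply (ω : MultilinearMap ℝ (fun _ : Fin 3 => L) R) (k : ℕ)
    (x : Fin k → L × R) :
    cocycleBrackets ω k x =
      (lieBrackets L k fun i => (x i).1, ternaryBrackets ω k fun i => (x i).1) :=
  rfl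

/-- An outer bracket sees only the `L`-component of an inner one, so an inner `ω` contributes
nothing. This removes the terms `l 2 ∘ l 3` and `l 3 ∘ l 3` from the generalized Jacobi identity. -/
theorem fst_cons_cocycleBrackets (ω : MultilinearMap ℝ (fun _ : Fin 3 => L) R) {k m : ℕ}
    (x : Fin k → L × R) (y : Fin m → L × R) :
    (fun i => (Fin.cons (α := fun _ => L × R) (cocycleBrackets ω k x) y i).1) =
      Fin.cons (α := fun _ => L) (lieBrackets L k fun i => (x i).1) fun i => (y i).1 := by
  funext i
  refine Fin.cases ?_ (fun _ => ?_) i <;> rfl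

variable [SuperSpace R]

/-- The closedness of a `3`-cocycle, written as a sum over unshuffles. -/
theorem sum_unshuffle_bracket_eq_zero {ω : MultilinearMap ℝ (fun _ : Fin 3 => L) R}
    (hω : IsEvenCocycle (SuperRep.trivial L R) ω) (a : Fin 4 → ZMod 2) (x : Fin 4 → L)
    (hx : ∀ i, x i ∈ SuperSpace.part (a i)) :
    ∑ σ ∈ Finset.univ.filter (IsUnshuffle (n := 4) 2),
      chiSign σ a • ω ![LieSuperalgebra.bracket (x (σ 0)) (x (σ 1)), x (σ 2), x (σ 3)] = 0 := by
  -- A (2,2)-unshuffle is determined by the pair of its first two values; the six are listed in the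
  -- order 01, 02, 03, 12, 13, 23.
  have hf : Finset.univ.filter (IsUnshuffle (n := 4) 2) =
      {1, Equiv.swap 1 2, Equiv.swap 1 3 * Equiv.swap 2 3, Equiv.swap 0 1 * Equiv.swap 1 2,
        Equiv.swap 0 1 * Equiv.swap 1 3 * Equiv.swap 3 2, Equiv.swap 0 2 * Equiv.swap 1 3} := by
    decide
  -- The `(i, j)` summand of `dω` matches the unshuffle that moves `i`, `j` to the front. Its sign
  -- is `(-1)^(i+j-1)` with indices from 0, which accounts for the overall factor `-1`.
  have term : ∀ (i : Fin 3) (j : Fin 4) (σ : Equiv.Perm (Fin 4)), σ 0 = i.castSucc → σ 1 = j →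
      σ 2 = j.succAbove (i.succAbove 0) → σ 3 = j.succAbove (i.succAbove 1) →
      (-1) ^ ((i : ℕ) + (j : ℕ)) * paritySign (a i.castSucc * a j) *
            frontSign a i.castSucc * frontSign a j = -chiSign σ a →
      ((-1) ^ ((i : ℕ) + (j : ℕ)) * paritySign (a i.castSucc * a j) *
            frontSign a i.castSucc * frontSign a j : ℤ) •
          ω (Fin.cons (LieSuperalgebra.bracket (x i.castSucc) (x j))
            fun k : Fin 2 => x (j.succAbove (i.succAbove k))) =
      -(chiSign σ a •
        ω ![LieSuperalgebra.bracket (x (σ 0)) (x (σ 1)), x (σ 2), x (σ 3)]) := by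
    intro i j σ h0 h1 h2 h3 hs
    rw [hs, neg_smul, h0, h1, h2, h3]
    congr 3
    funext k
    fin_cases k <;> rfl
  have h := hω.closed a x hx
  simp only [coboundary, coboundaryBracketPart, SuperRep.trivial, LinearMap.zero_apply, smul_zero,
    Finset.sum_const_zero, zero_add] at h
  have hsum : ∀ f : Equiv.Perm (Fin 4) → R,
      ∑ σ ∈ Finset.univ.filter (IsUnshuffle (n := 4) 2), f σ =
      f 1 + (f (Equiv.swap 1 2) + (f (Equiv.swap 1 3 * Equiv.swap 2 3) +
        (f (Equiv.swap 0 1 * Equiv.swap 1 2) +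
        (f (Equiv.swap 0 1 * Equiv.swap 1 3 * Equiv.swap 3 2) +
          f (Equiv.swap 0 2 * Equiv.swap 1 3))))) := by
    intro f
    rw [hf, Finset.sum_insert (by decide), Finset.sum_insert (by decide),
      Finset.sum_insert (by decide), Finset.sum_insert (by decide),
      Finset.sum_insert (by decide), Finset.sum_singleton]
  rw [hsum]
  -- Of the twelve index pairs, six satisfy `i < j`. Each sign comparison is a finite check over the
  -- 16 parity patterns.
  rw [Fin.sum_univ_three, Fin.sum_univ_four, Fin.sum_univ_four, Fin.sum_univ_four,
    if_neg (by decide), if_pos (by decide), if_pos (by decide), if_pos (by decide),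
    if_neg (by decide), if_neg (by decide), if_pos (by decide), if_pos (by decide),
    if_neg (by decide), if_neg (by decide), if_neg (by decide), if_pos (by decide),
    term 0 1 1 rfl rfl rfl rfl (by clear * - ; revert a; decide),
    term 0 2 (Equiv.swap 1 2) (by decide) (by decide) (by decide) (by decide)
      (by clear * - ; revert a; decide),
    term 0 3 (Equiv.swap 1 3 * Equiv.swap 2 3) (by decide) (by decide) (by decide) (by decide)
      (by clear * - ; revert a; decide),
    term 1 2 (Equiv.swap 0 1 * Equiv.swap 1 2) (by decide) (by decide) (by decide) (by decide)
      (by clear * - ; revert a; decide),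
    term 1 3 (Equiv.swap 0 1 * Equiv.swap 1 3 * Equiv.swap 3 2) (by decide) (by decide)
      (by decide) (by decide) (by clear * - ; revert a; decide),
    term 2 3 (Equiv.swap 0 2 * Equiv.swap 1 3) (by decide) (by decide) (by decide) (by decide)
      (by clear * - ; revert a; decide)] at h
  rw [← neg_eq_zero, ← h]
  abel

/-- The Jacobi identity for the ternary bracket. -/
theorem ternaryBrackets_jacobi {ω : MultilinearMap ℝ (fun _ : Fin 3 => L) R}
    (hω : IsEvenCocycle (SuperRep.trivial L R) ω) (n : ℕ) (p : Fin n → ℤ) (a : Fin n → ZMod 2)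
    (x : Fin n → L) (hx : ∀ i, x i ∈ singleGrading L 0 (p i) (a i)) :
    ∑ i : Fin (n + 1), (if (i : ℕ) = 0 then 0 else
        ∑ σ ∈ Finset.univ.filter (IsUnshuffle (n := n) i),
          (chiSign σ (fun m => (p m : ZMod 2) + a m) * (-1) ^ ((i : ℕ) * (n - (i : ℕ))) : ℤ) •
            ternaryBrackets ω (n - (i : ℕ) + 1)
              (Fin.cons (lieBrackets L i fun m : Fin (i : ℕ) => x (σ ⟨m, by omega⟩))
                fun m : Fin (n - (i : ℕ)) => x (σ ⟨(i : ℕ) + m, by omega⟩))) = 0 := by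
  refine Finset.sum_eq_zero fun i _ => ?_
  -- The inner bracket must be binary and the outer one ternary, so `n - 2 + 1 = 3` and only `n = 4`
  -- matters.
  by_cases hi : (i : ℕ) = 2
  · by_cases hn : n = 4
    · subst hn
      obtain rfl : i = 2 := Fin.ext hi
      rw [if_neg (by simp)]
      by_cases hp : ∀ i, p i = 0
      · have hx' : ∀ i, x i ∈ SuperSpace.part (a i) := fun i => by
          simpa [singleGrading, hp] using hx i
        simp only [hp, Int.cast_zero, zero_add]
        refine Eq.trans (Finset.sum_congr rfl fun σ _ => ?_)
          (sum_unshuffle_bracket_eq_zero hω a x hx')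
        change (chiSign σ a * 1 : ℤ) • _ = _
        rw [mul_one]
        congr 1
        change ω _ = ω _
        congr 1
        funext k
        fin_cases k <;> rfl
      · push Not at hp
        obtain ⟨m, hm⟩ := hp
        have h0 : x m = 0 := eq_zero_of_mem_singleGrading (by simpa using hm) (hx m)
        refine Finset.sum_eq_zero fun σ _ => ?_
        -- An argument of nonzero degree has zero `L`-component. It occupies slot `σ⁻¹ m`: inside
        -- the inner bracket if that is below 2, otherwise in the outer bracket, after the inserted
        -- first entry. Either way the term vanishes.
        by_cases hmi : (σ.symm m : ℕ) < 2
        · rw [MultilinearMap.map_coord_zero _ 0, smul_zero]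
          rw [Fin.cons_zero]
          refine MultilinearMap.map_coord_zero _ ⟨(σ.symm m : ℕ), hmi⟩ ?_
          simpa using h0
        · rw [MultilinearMap.map_coord_zero _
            (Fin.succ ⟨(σ.symm m : ℕ) - 2, by simp; omega⟩), smul_zero]
          rw [Fin.cons_succ]
          have e : ∀ h, (⟨2 + ((σ.symm m : ℕ) - 2), h⟩ : Fin 4) = σ.symm m :=
            fun h => Fin.ext (by simp; omega)
          simp [e, h0]
    · rw [if_neg (by omega)]
      refine Finset.sum_eq_zero fun σ _ => ?_
      rw [ternaryBrackets_ne ω (k := n - (i : ℕ) + 1) (by omega)]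
      simp
  · split_ifs
    · rfl
    · refine Finset.sum_eq_zero fun σ _ => ?_
      rw [MultilinearMap.map_coord_zero _ 0, smul_zero]
      rw [Fin.cons_zero, lieBrackets_ne L hi]
      rfl

/-- The L∞-superalgebra on `L ⊕ R`, with `L` in degree `0` and `R` in degree `1`, whose binary
bracket is the Lie bracket of `L` and whose ternary bracket is the cocycle `ω`. -/
def ofCocycle (ω : MultilinearMap ℝ (fun _ : Fin 3 => L) R)
    (hω : IsEvenCocycle (SuperRep.trivial L R) ω) : LInftySuperalgebra (L × R) where
  gr p a := (singleGrading L 0 p a).prod (singleGrading R 1 p a)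
  internal :=
    Submodule.isInternal_prod (singleGrading_isInternal L 0) (singleGrading_isInternal R 1)
  gr_neg p a hp := by
    rw [singleGrading_of_ne (by simp; omega), singleGrading_of_ne (by simp; omega),
      Submodule.prod_bot]
  l := cocycleBrackets ω
  l_zero := rfl
  l_mem k p a x hx := by
    refine ⟨(ofLie L).l_mem k p a (fun i => (x i).1) fun i => (hx i).1, ?_⟩
    rw [cocycleBrackets_apply]
    by_cases hk : k = 3
    · subst hk
      by_cases hp : ∀ i, p i = 0
      -- Three arguments of degree 0 give degree `0 + 3 - 2 = 1`, where `R` sits.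
      · have := hω.even a (fun i => (x i).1) fun i => by
          simpa [singleGrading, hp] using (hx i).1
        simpa [singleGrading, hp, ternaryBrackets] using this
      · push Not at hp
        obtain ⟨i, hi⟩ := hp
        have h0 : (x i).1 = 0 := eq_zero_of_mem_singleGrading (by simpa using hi) (hx i).1
        rw [MultilinearMap.map_coord_zero (ternaryBrackets ω 3) i h0]
        exact Submodule.zero_mem _
    · simp [ternaryBrackets_ne ω hk]
  antisymm k σ p a x hx := by
    refine Prod.ext ((ofLie L).antisymm k σ p a (fun i => (x i).1) fun i => (hx i).1) ?_
    rw [Prod.smul_snd, cocycleBrackets_apply, cocycleBrackets_apply]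
    by_cases hk : k = 3
    · subst hk
      by_cases hp : ∀ i, p i = 0
      · have := hω.isCochain σ a (fun i => (x i).1) fun i => by
          simpa [singleGrading, hp] using (hx i).1
        simp only [hp, Int.cast_zero, zero_add]
        exact this
      · push Not at hp
        obtain ⟨i, hi⟩ := hp
        have h0 : (x i).1 = 0 := eq_zero_of_mem_singleGrading (by simpa using hi) (hx i).1
        rw [MultilinearMap.map_coord_zero (ternaryBrackets ω 3) (σ.symm i) (by simpa using h0),
          MultilinearMap.map_coord_zero (ternaryBrackets ω 3) i h0,
          smul_zero]
    · simp [ternaryBrackets_ne ω hk]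
  jacobi n p a x hx := by
    refine Prod.ext (Eq.trans ?_ ((ofLie L).jacobi n p a (fun i => (x i).1) fun i => (hx i).1))
      (Eq.trans ?_ (ternaryBrackets_jacobi hω n p a (fun i => (x i).1) fun i => (hx i).1))
    · rw [Prod.fst_sum]
      refine Finset.sum_congr rfl fun i _ => ?_
      split_ifs
      · rfl
      · rw [Prod.fst_sum]
        refine Finset.sum_congr rfl fun σ _ => ?_
        rw [Prod.smul_fst, cocycleBrackets_apply, fst_cons_cocycleBrackets]
        rfl
    · rw [Prod.snd_sum]
      refine Finset.sum_congr rfl fun i _ => ?_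
      split_ifs
      · rfl
      · rw [Prod.snd_sum]
        refine Finset.sum_congr rfl fun σ _ => ?_
        rw [Prod.smul_snd, cocycleBrackets_apply, fst_cons_cocycleBrackets]

variable (ω : MultilinearMap ℝ (fun _ : Fin 3 => L) R)
  (hω : IsEvenCocycle (SuperRep.trivial L R) ω)

theorem ofCocycle_isLie : (ofCocycle ω hω).IsLie 2 := by
  intro p a hp
  change (singleGrading L 0 p a).prod (singleGrading R 1 p a) = ⊥
  rw [singleGrading_of_ne (by simp; omega), singleGrading_of_ne (by simp; omega),
    Submodule.prod_bot]

theorem ofCocycle_correspondsTo :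
    (ofCocycle ω hω).CorrespondsTo (n := 1) (SuperRep.trivial L R) ω := by
  refine ⟨one_pos, hω, fun p a h0 h1 => ?_, ?_, LinearMap.inl ℝ L R, LinearMap.inr ℝ L R,
    LinearMap.inl_injective, LinearMap.inr_injective, fun a => ?_, fun a => ?_, fun x y => ?_,
    fun x v => ?_, fun x => ?_⟩
  · change (singleGrading L 0 p a).prod (singleGrading R 1 p a) = ⊥
    rw [singleGrading_of_ne (by simpa using h0), singleGrading_of_ne (by simpa using h1),
      Submodule.prod_bot]
  · rfl
  · change _ = (singleGrading L 0 0 a).prod (singleGrading R 1 0 a)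
    rw [singleGrading_of_ne (n := 1) (by simp), Submodule.map_inl]
    simp [singleGrading]
  · change _ = (singleGrading L 0 1 a).prod (singleGrading R 1 1 a)
    rw [singleGrading_of_ne (n := 0) (by simp), Submodule.map_inr]
    simp [singleGrading]
  · rfl
  · refine Prod.ext ?_ rfl
    change LieSuperalgebra.bracket x 0 = 0
    simp
  · change cocycleBrackets ω 3 _ = _
    rw [cocycleBrackets_apply, lieBrackets_ne L (by decide)]
    rfl

theorem ofCocycle_isExtension : (ofCocycle ω hω).IsExtension L R 1 := by
  refine ⟨⟨LinearMap.inr ℝ L R, fun p a x hx => ⟨Submodule.zero_mem _, hx⟩, fun k x => ?_⟩,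
    ⟨LinearMap.fst ℝ L R, fun p a x hx => hx.1, fun k x => rfl⟩,
    LinearMap.inr_injective, Function.Exact.inr_fst, LinearMap.fst_surjective⟩
  change LinearMap.inr ℝ L R 0 = cocycleBrackets ω k fun i => LinearMap.inr ℝ L R (x i)
  rw [map_zero, cocycleBrackets_apply]
  -- A bracket of elements of `R` vanishes because some argument has zero `L`-component; with no
  -- arguments there is none to use, so `k = 0` is separate.
  rcases k with _ | k
  · rfl
  · rw [MultilinearMap.map_coord_zero (lieBrackets L (k + 1)) 0 rfl,
      MultilinearMap.map_coord_zero (ternaryBrackets ω (k + 1)) 0 rfl]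
    rfl

end OfCocycle

end LInftySuperalgebra

/-! ### Null vectors, the cyclic spinor identity and the closedness of `α` -/

section StringCocycle

variable {K : Type*} [NonAssocRing K] [StarRing K] [Module ℝ K] [NormedDivisionAlgebra K]

theorem minkowski_comm (A B : Vec K) : minkowski A B = minkowski B A := by
  have := divRe_mul_star_comm (A.1 0 1) (B.1 0 1)
  simp [minkowski]
  linarith

/-- The vector `ψ · ψ` is null. -/
theorem minkowski_spinorBracket_self (ψ : Spinor K) :
    minkowski (spinorBracket ψ ψ) (spinorBracket ψ ψ) = 0 := by
  -- Trace reversal swaps and negates the diagonal entries, so it preserves the determinant. What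
  -- remains is `|ψ₀ψ₁*|² = |ψ₀|²|ψ₁|²`.
  have N := NormedDivisionAlgebra.normSq_mul (ψ 0) (star (ψ 1))
  change divRe _ = divRe _ * divRe _ at N
  have h := divRe_mul_comm (star (ψ 1)) (ψ 1)
  rw [star_star, h] at N
  rw [minkowski_self]
  simp [spinorBracket, spinorOuter, traceReversal, Matrix.vecMulVec, Matrix.trace_fin_two,
    add_mul, mul_add] at N ⊢
  linarith

/-- The polarization of `minkowski_spinorBracket_self`, known as the `3`-`ψ` rule. -/
theorem minkowski_spinorBracket_cyclic (ψ₀ ψ₁ ψ₂ ψ₃ : Spinor K) :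
    minkowski (spinorBracket ψ₀ ψ₁) (spinorBracket ψ₂ ψ₃) +
      minkowski (spinorBracket ψ₀ ψ₂) (spinorBracket ψ₁ ψ₃) +
      minkowski (spinorBracket ψ₀ ψ₃) (spinorBracket ψ₁ ψ₂) = 0 := by
  -- The quartic form vanishes at `φ + tχ` for all `t`. Its `t` and `t³` coefficients are multiples
  -- of `g(φ·φ, φ·χ)` and `g(φ·χ, χ·χ)`; as the extreme coefficients are zero, the values `t = 1,
  -- -1, 2` determine the three middle ones.
  have cube : ∀ φ χ : Spinor K, minkowski (spinorBracket φ φ) (spinorBracket φ χ) = 0 := by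
    intro φ χ
    have h1 := minkowski_spinorBracket_self (φ + χ)
    have h2 := minkowski_spinorBracket_self (φ - χ)
    have h3 := minkowski_spinorBracket_self (φ + (2 : ℝ) • χ)
    have h4 := minkowski_spinorBracket_self φ
    have h5 := minkowski_spinorBracket_self χ
    have c1 := minkowski_comm (spinorBracket φ χ) (spinorBracket φ φ)
    have c2 := minkowski_comm (spinorBracket χ χ) (spinorBracket φ φ)
    have c3 := minkowski_comm (spinorBracket χ χ) (spinorBracket φ χ)
    simp only [map_add, map_sub, map_smul, LinearMap.add_apply, LinearMap.sub_apply,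
      LinearMap.smul_apply, smul_eq_mul, spinorBracket_comm χ φ, c1, c2, c3, h4, h5] at h1 h2 h3
    linarith
  -- The cubic form in `φ` is polarized by inclusion-exclusion: the triple sum minus the pair sums
  -- leaves twice the cyclic expression.
  have h012 := cube (ψ₀ + ψ₁ + ψ₂) ψ₃
  have h01 := cube (ψ₀ + ψ₁) ψ₃
  have h02 := cube (ψ₀ + ψ₂) ψ₃
  have h12 := cube (ψ₁ + ψ₂) ψ₃
  have h0 := cube ψ₀ ψ₃
  have h1 := cube ψ₁ ψ₃
  have h2 := cube ψ₂ ψ₃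
  have c := minkowski_comm (spinorBracket ψ₁ ψ₂) (spinorBracket ψ₀ ψ₃)
  simp only [map_add, LinearMap.add_apply, spinorBracket_comm ψ₁ ψ₀, spinorBracket_comm ψ₂ ψ₀,
    spinorBracket_comm ψ₂ ψ₁, h0, h1, h2] at h012 h01 h02 h12
  linarith

/-- The two standard basis spinors have as bracket the off-diagonal matrix with entries 1, of square
norm 1. Equal spinors would not do, since `ψ · ψ` is null. -/
theorem exists_minkowski_spinorBracket_ne_zero :
    ∃ ψ φ : Spinor K, minkowski (spinorBracket ψ φ) (spinorBracket ψ φ) ≠ 0 := by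
  refine ⟨![1, 0], ![0, 1], ?_⟩
  have r1 : divRe (1 : K) ≠ 0 := by
    have := NormedDivisionAlgebra.normSq_pos (1 : K) one_ne_zero
    rw [star_one, mul_one] at this
    exact this.ne'
  rw [minkowski_self]
  simpa [spinorBracket, spinorOuter, traceReversal, Matrix.vecMulVec, Matrix.trace_fin_two] using r1

theorem SuperTranslation.snd_eq_zero {X : SuperTranslation K}
    (hX : X ∈ SuperSpace.part (V := SuperTranslation K) 0) : X.2 = 0 := by
  obtain ⟨A, rfl⟩ := hX
  rfl

theorem SuperTranslation.fst_eq_zero {X : SuperTranslation K}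
    (hX : X ∈ SuperSpace.part (V := SuperTranslation K) 1) : X.1 = 0 := by
  obtain ⟨A, rfl⟩ := hX
  rfl

theorem stringCocycle_apply (X : Fin 3 → SuperTranslation K) :
    stringCocycle X = minkowski (spinorBracket (X 0).2 (X 1).2) (X 2).1 -
      minkowski (spinorBracket (X 0).2 (X 2).2) (X 1).1 +
      minkowski (spinorBracket (X 1).2 (X 2).2) (X 0).1 :=
  rfl

theorem ZMod.two_eq_zero_or_one (c : ZMod 2) : c = 0 ∨ c = 1 := by
  revert c; decide

theorem stringCocycle_isCochain : IsCochain (stringCocycle (K := K)) := by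
  intro σ a x hx
  have hσ : σ = 1 ∨ σ = Equiv.swap 0 1 ∨ σ = Equiv.swap 0 2 ∨ σ = Equiv.swap 1 2 ∨
      σ = finRotate 3 ∨ σ = (finRotate 3).symm := by
    revert σ; decide
  have h0 : ∀ i, a i = 0 → (x i).2 = 0 := fun i h => SuperTranslation.snd_eq_zero (h ▸ hx i)
  have h1 : ∀ i, a i = 1 → (x i).1 = 0 := fun i h => SuperTranslation.fst_eq_zero (h ▸ hx i)
  have c0 : ∀ a : Fin 3 → ZMod 2, chiSign (1 : Equiv.Perm (Fin 3)) a = 1 := by decide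
  have c1 : ∀ a : Fin 3 → ZMod 2,
      chiSign (Equiv.swap 0 1 : Equiv.Perm (Fin 3)) a = -paritySign (a 0 * a 1) := by decide
  have c2 : ∀ a : Fin 3 → ZMod 2, chiSign (Equiv.swap 0 2 : Equiv.Perm (Fin 3)) a =
      -(paritySign (a 0 * a 1) * paritySign (a 0 * a 2) * paritySign (a 1 * a 2)) := by decide
  have c3 : ∀ a : Fin 3 → ZMod 2,
      chiSign (Equiv.swap 1 2 : Equiv.Perm (Fin 3)) a = -paritySign (a 1 * a 2) := by decide
  have c4 : ∀ a : Fin 3 → ZMod 2,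
      chiSign (finRotate 3) a = paritySign (a 0 * a 1) * paritySign (a 0 * a 2) := by decide
  have c5 : ∀ a : Fin 3 → ZMod 2,
      chiSign (finRotate 3).symm a = paritySign (a 0 * a 2) * paritySign (a 1 * a 2) := by decide
  have p0 : paritySign 0 = 1 := rfl
  have p1 : paritySign 1 = -1 := rfl
  have r0 : (finRotate 3).symm 0 = 2 := by decide
  have r1 : (finRotate 3).symm 1 = 0 := by decide
  have r2 : (finRotate 3).symm 2 = 1 := by decide
  have r3 : finRotate 3 0 = 1 := by decide
  have r4 : finRotate 3 1 = 2 := by decide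
  have r5 : finRotate 3 2 = 0 := by decide
  have s0 : (Equiv.swap 0 1 : Equiv.Perm (Fin 3)) 2 = 2 := by decide
  have s1 : (Equiv.swap 0 2 : Equiv.Perm (Fin 3)) 1 = 1 := by decide
  have s2 : (Equiv.swap 1 2 : Equiv.Perm (Fin 3)) 0 = 0 := by decide
  have comm := spinorBracket_comm (K := K)
  -- Six permutations times eight parity patterns. A term survives only for two spinors and one
  -- vector, and then its sign is compared with `chiSign`.
  rcases hσ with rfl | rfl | rfl | rfl | rfl | rfl <;>
  simp only [stringCocycle_apply, Function.comp_apply, c0, c1, c2, c3, c4, c5, r0, r1, r2, r3, r4,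
    r5, s0, s1, s2, Equiv.swap_apply_left, Equiv.swap_apply_right, Equiv.Perm.one_apply,
    comm (x 1).2 (x 0).2, comm (x 2).2 (x 0).2, comm (x 2).2 (x 1).2] <;>
  rcases ZMod.two_eq_zero_or_one (a 0) with e0 | e0 <;>
  rcases ZMod.two_eq_zero_or_one (a 1) with e1 | e1 <;>
  rcases ZMod.two_eq_zero_or_one (a 2) with e2 | e2 <;>
  simp [e0, e1, e2, h0, h1, p0, p1]

theorem stringCocycle_hasParity : HasParity 0 (stringCocycle (K := K)) := by
  intro a x hx
  have h0 : ∀ i, a i = 0 → (x i).2 = 0 := fun i h => SuperTranslation.snd_eq_zero (h ▸ hx i)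
  have h1 : ∀ i, a i = 1 → (x i).1 = 0 := fun i h => SuperTranslation.fst_eq_zero (h ▸ hx i)
  rw [stringCocycle_apply]
  rcases ZMod.two_eq_zero_or_one (a 0) with e0 | e0 <;>
  rcases ZMod.two_eq_zero_or_one (a 1) with e1 | e1 <;>
  rcases ZMod.two_eq_zero_or_one (a 2) with e2 | e2 <;>
  simp [Fin.sum_univ_three, e0, e1, e2, h0, h1, SuperSpace.part, CharTwo.add_self_eq_zero]

theorem stringCocycle_isEvenCocycle :
    IsEvenCocycle (SuperRep.trivial (SuperTranslation K) ℝ) (stringCocycle (K := K)) := by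
  refine ⟨stringCocycle_isCochain, stringCocycle_hasParity, fun a X hX => ?_⟩
  have h0 : ∀ i, a i = 0 → (X i).2 = 0 := fun i h => SuperTranslation.snd_eq_zero (h ▸ hX i)
  have hr := minkowski_spinorBracket_cyclic (X 0).2 (X 1).2 (X 2).2 (X 3).2
  -- A bracket has no spinor component, so just one of the three terms of `α` remains.
  have hb : ∀ (x y : SuperTranslation K) (f : Fin 2 → SuperTranslation K),
      stringCocycle (Fin.cons (LieSuperalgebra.bracket x y) f) =
        minkowski (spinorBracket (f 0).2 (f 1).2) (spinorBracket x.2 y.2) := by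
    intro x y f
    have e1 : (Fin.cons (LieSuperalgebra.bracket x y) f : Fin 3 → SuperTranslation K) 1 = f 0 := rfl
    have e2 : (Fin.cons (LieSuperalgebra.bracket x y) f : Fin 3 → SuperTranslation K) 2 = f 1 := rfl
    have eb : LieSuperalgebra.bracket x y = (spinorBracket x.2 y.2, (0 : Spinor K)) := rfl
    rw [stringCocycle_apply, e1, e2, Fin.cons_zero, eb]
    simp
  have hs : ∀ (i : Fin 3) (j : Fin 4), i.castSucc < j →
      (-1) ^ ((i : ℕ) + (j : ℕ)) * paritySign (1 * 1) * frontSign (fun _ : Fin 4 => 1) i.castSucc *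
        frontSign (fun _ : Fin 4 => 1) j = -1 := by
    decide
  simp only [coboundary, coboundaryBracketPart, SuperRep.trivial, LinearMap.zero_apply, smul_zero,
    Finset.sum_const_zero, zero_add, hb]
  rw [Fin.sum_univ_three, Fin.sum_univ_four, Fin.sum_univ_four, Fin.sum_univ_four,
    if_neg (by decide), if_pos (by decide), if_pos (by decide), if_pos (by decide),
    if_neg (by decide), if_neg (by decide), if_pos (by decide), if_pos (by decide),
    if_neg (by decide), if_neg (by decide), if_neg (by decide), if_pos (by decide)]
  by_cases ha : ∀ i, a i = 1
  · obtain rfl : a = fun _ => 1 := funext ha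
    rw [hs 0 1 (by decide), hs 0 2 (by decide), hs 0 3 (by decide), hs 1 2 (by decide),
      hs 1 3 (by decide), hs 2 3 (by decide)]
    change 0 + -1 • minkowski (spinorBracket (X 2).2 (X 3).2) (spinorBracket (X 0).2 (X 1).2) +
      -1 • minkowski (spinorBracket (X 1).2 (X 3).2) (spinorBracket (X 0).2 (X 2).2) +
      -1 • minkowski (spinorBracket (X 1).2 (X 2).2) (spinorBracket (X 0).2 (X 3).2) +
      (0 + 0 + -1 • minkowski (spinorBracket (X 0).2 (X 3).2) (spinorBracket (X 1).2 (X 2).2) +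
      -1 • minkowski (spinorBracket (X 0).2 (X 2).2) (spinorBracket (X 1).2 (X 3).2)) +
      (0 + 0 + 0 +
        -1 • minkowski (spinorBracket (X 0).2 (X 1).2) (spinorBracket (X 2).2 (X 3).2)) = 0
    -- Symmetry of `g` identifies the terms of complementary pairs, so the six equal-signed terms
    -- are twice the cyclic sum.
    rw [minkowski_comm (spinorBracket (X 2).2 (X 3).2),
      minkowski_comm (spinorBracket (X 1).2 (X 3).2),
      minkowski_comm (spinorBracket (X 1).2 (X 2).2)]
    simp only [neg_smul, one_smul]
    linarith
  · push Not at ha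
    obtain ⟨m, hm⟩ := ha
    have hm0 := h0 m ((ZMod.two_eq_zero_or_one _).resolve_right hm)
    -- Each summand involves all four spinor components, so a single even argument kills every one.
    have z : ∀ (n : ℤ) (i j k l : Fin 4), m = i ∨ m = j ∨ m = k ∨ m = l →
        n • minkowski (spinorBracket (X i).2 (X j).2) (spinorBracket (X k).2 (X l).2) = 0 := by
      rintro n i j k l (rfl | rfl | rfl | rfl) <;> simp [hm0]
    rw [z, z, z, z, z, z]
    · simp
    all_goals
      clear * -
      revert m
      decide

end StringCocycle

/-! ### Coboundaries on a triple closed under the bracket -/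

section Trivial

variable {L R : Type*} [AddCommGroup L] [Module ℝ L] [SuperSpace L]
  [AddCommGroup R] [Module ℝ R]

/-- On even elements super-skew-symmetry is ordinary skew-symmetry; on odd elements a cochain would
be symmetric. -/
theorem IsCochain.apply_even_self {θ : MultilinearMap ℝ (fun _ : Fin 2 => L) R}
    (hθ : IsCochain θ) {x : L} (hx : x ∈ SuperSpace.part (V := L) 0) : θ (fun _ => x) = 0 := by
  have h := hθ (Equiv.swap 0 1) (fun _ => 0) (fun _ => x) fun _ => hx
  have hs : chiSign (Equiv.swap 0 1 : Equiv.Perm (Fin 2)) (fun _ => 0) = -1 := by decide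
  rw [hs, neg_smul, one_smul] at h
  have h2 : (2 : ℝ) • θ (fun _ => x) = 0 := by
    rw [two_smul]
    exact eq_neg_iff_add_eq_zero.1 h
  exact (smul_eq_zero.1 h2).resolve_left two_ne_zero

/-- The only term not killed by a vanishing action or bracket is a multiple of `θ(X₂, X₂)`. Signs
play no role, so even and odd cochains are treated at once. -/
theorem IsCochain.coboundary_eq_zero [SuperSpace R] [LieSuperalgebra L] {ρ : SuperRep L R}
    (hρ : ∀ x v, ρ.act x v = 0) (c : ZMod 2) {θ : MultilinearMap ℝ (fun _ : Fin 2 => L) R}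
    (hθ : IsCochain θ) (a : Fin 3 → ZMod 2) (X : Fin 3 → L)
    (h01 : LieSuperalgebra.bracket (X 0) (X 1) = X 2)
    (h02 : LieSuperalgebra.bracket (X 0) (X 2) = 0)
    (h12 : LieSuperalgebra.bracket (X 1) (X 2) = 0)
    (h2 : X 2 ∈ SuperSpace.part (V := L) 0) : coboundary ρ c θ a X = 0 := by
  have e01 : θ (Fin.cons (LieSuperalgebra.bracket (X 0) (X 1)) fun k : Fin 1 =>
      X ((1 : Fin 3).succAbove ((0 : Fin 2).succAbove k))) = 0 := by
    rw [h01, ← hθ.apply_even_self h2]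
    congr 1
    funext k
    fin_cases k <;> rfl
  have e02 : θ (Fin.cons (LieSuperalgebra.bracket (X 0) (X 2)) fun k : Fin 1 =>
      X ((2 : Fin 3).succAbove ((0 : Fin 2).succAbove k))) = 0 := by
    rw [h02]
    exact MultilinearMap.map_coord_zero _ 0 rfl
  have e12 : θ (Fin.cons (LieSuperalgebra.bracket (X 1) (X 2)) fun k : Fin 1 =>
      X ((2 : Fin 3).succAbove ((1 : Fin 2).succAbove k))) = 0 := by
    rw [h12]
    exact MultilinearMap.map_coord_zero _ 0 rfl
  simp only [coboundary, coboundaryBracketPart, hρ, smul_zero, Finset.sum_const_zero, zero_add]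
  rw [Fin.sum_univ_two, Fin.sum_univ_three, Fin.sum_univ_three,
    if_neg (by decide), if_pos (by decide), if_pos (by decide), if_neg (by decide),
    if_neg (by decide), if_pos (by decide)]
  simp only [Fin.castSucc_zero, Fin.castSucc_one]
  rw [e01, e02, e12]
  simp

end Trivial

/-! ### Non-exactness -/

namespace LInftySuperalgebra

variable {K : Type*} [NonAssocRing K] [StarRing K] [Module ℝ K] [NormedDivisionAlgebra K]

theorem ofCocycle_stringCocycle_not_isExact :
    ¬ (ofCocycle (stringCocycle (K := K)) stringCocycle_isEvenCocycle).IsExact 1 := by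
  rintro ⟨-, g, R, _, _, _, _, _, _, _, ρ, ω,
    ⟨-, -, -, -, e₀, e₁, inj₀, inj₁, gr₀, gr₁, hbr, hact, hω⟩, θ₀, θ₁, hθ₀, -, hθ₁, -, h⟩
  change ∀ a, _ = (singleGrading (SuperTranslation K) 0 0 a).prod (singleGrading ℝ 1 0 a) at gr₀
  change ∀ a, _ = (singleGrading (SuperTranslation K) 0 1 a).prod (singleGrading ℝ 1 1 a) at gr₁
  -- The image of `e₁` is the degree 1 part, which is `ℝ`. Brackets ignore that component, so
  -- injectivity of `e₁` forces the action `ρ` to vanish.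
  have he₁ : ∀ v, (e₁ v).1 = 0 := by
    intro v
    have hmem : ∀ a, ∀ w ∈ SuperSpace.part (V := R) a, (e₁ w).1 = 0 := fun a w hw => by
      have := gr₁ a ▸ Submodule.mem_map_of_mem hw
      exact eq_zero_of_mem_singleGrading (by simp) this.1
    have hv : v ∈ SuperSpace.part (V := R) 0 ⊔ SuperSpace.part 1 := by
      rw [SuperSpace.isCompl.sup_eq_top]
      trivial
    obtain ⟨v₀, h₀, v₁, h₁, rfl⟩ := Submodule.mem_sup.1 hv
    rw [map_add, Prod.fst_add, hmem _ _ h₀, hmem _ _ h₁, add_zero]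
  have hρ : ∀ x v, ρ.act x v = 0 := by
    intro x v
    apply inj₁
    rw [map_zero, ← hact]
    refine Prod.ext ?_ rfl
    change LieSuperalgebra.bracket (e₀ x).1 (e₁ v).1 = 0
    rw [he₁, map_zero]
  -- Since `e₀` maps each parity part of `g` onto that of degree 0, homogeneous elements of `T` lift
  -- with their parity. Injectivity of `e₀` then transfers the bracket relations of the triple to
  -- `g`.
  have lift : ∀ (a : ZMod 2) (x : SuperTranslation K), x ∈ SuperSpace.part a →
      ∃ y ∈ SuperSpace.part (V := g) a, e₀ y = (x, 0) := by
    intro a x hx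
    have : ((x, 0) : SuperTranslation K × ℝ) ∈ (SuperSpace.part (V := g) a).map e₀ := by
      rw [gr₀]
      refine ⟨?_, Submodule.zero_mem _⟩
      simpa [singleGrading] using hx
    exact this
  obtain ⟨ψ, φ, hne⟩ := exists_minkowski_spinorBracket_ne_zero (K := K)
  obtain ⟨y₀, m₀, q₀⟩ := lift 1 (0, ψ) ⟨ψ, rfl⟩
  obtain ⟨y₁, m₁, q₁⟩ := lift 1 (0, φ) ⟨φ, rfl⟩
  obtain ⟨y₂, m₂, q₂⟩ := lift 0 (spinorBracket ψ φ, 0) ⟨spinorBracket ψ φ, rfl⟩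
  have b01 : LieSuperalgebra.bracket y₀ y₁ = y₂ := by
    apply inj₀
    rw [← hbr, q₀, q₁, q₂]
    rfl
  have b02 : LieSuperalgebra.bracket y₀ y₂ = 0 := by
    apply inj₀
    rw [← hbr, q₀, q₂, map_zero]
    refine Prod.ext ?_ rfl
    change ((spinorBracket ψ 0, 0) : SuperTranslation K) = 0
    rw [map_zero]
    rfl
  have b12 : LieSuperalgebra.bracket y₁ y₂ = 0 := by
    apply inj₀
    rw [← hbr, q₁, q₂, map_zero]
    refine Prod.ext ?_ rfl
    change ((spinorBracket φ 0, 0) : SuperTranslation K) = 0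
    rw [map_zero]
    rfl
  have hX := h ![1, 1, 0] ![y₀, y₁, y₂] (by intro i; fin_cases i <;> assumption)
  rw [hθ₀.coboundary_eq_zero hρ 0 _ ![y₀, y₁, y₂] b01 b02 b12 m₂,
    hθ₁.coboundary_eq_zero hρ 1 _ ![y₀, y₁, y₂] b01 b02 b12 m₂, add_zero] at hX
  -- The ternary bracket of the triple is `e₁` of the vanishing `ω`-value, yet its `ℝ`-component is
  -- `g(ψ · φ, ψ · φ)`.
  have hv := hω ![y₀, y₁, y₂]
  have ho : ω ![y₀, y₁, y₂] = 0 := hX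
  rw [ho, map_zero] at hv
  have hv' : stringCocycle (fun i => (e₀ (![y₀, y₁, y₂] i)).1) = 0 := congrArg Prod.snd hv
  rw [stringCocycle_apply] at hv'
  simp [q₀, q₁, q₂] at hv'
  exact hne hv'

end LInftySuperalgebra

/-! ### Dimensions of the spaces of vectors -/

section Dimension

variable {K : Type*} [NonAssocRing K] [StarRing K] [Module ℝ K] [NormedDivisionAlgebra K]

theorem divRe_one : divRe (1 : K) = 1 := by
  have h := NormedDivisionAlgebra.add_star_eq (1 : K)
  rw [star_one, ← two_smul ℝ (1 : K)] at h
  have := smul_left_injective ℝ (one_ne_zero (α := K)) h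
  simp only [divRe]
  linarith

/-- A hermitian matrix is determined by its real diagonal entries and one entry off the
diagonal. -/
def vecEquiv : Vec K ≃ₗ[ℝ] ℝ × ℝ × K where
  toFun A := (divRe (A.1 0 0), divRe (A.1 1 1), A.1 0 1)
  invFun x := ⟨!![x.1 • 1, x.2.2; star x.2.2, x.2.1 • 1], by
    change Matrix.conjTranspose _ = _
    ext i j
    fin_cases i <;> fin_cases j <;> simp⟩
  map_add' A B := by simp
  map_smul' c A := by simp
  left_inv A := by
    have hA : ∀ i j, star (A.1 j i) = A.1 i j := fun i j => congrFun (congrFun A.2 i) j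
    apply Subtype.ext
    ext i j
    fin_cases i <;> fin_cases j
    · exact (eq_divRe_smul_one (hA 0 0)).symm
    · rfl
    · exact hA 1 0
    · exact (eq_divRe_smul_one (hA 1 1)).symm
  right_inv x := by simp [divRe_one]

theorem finrank_vec : Module.finrank ℝ (Vec K) = Module.finrank ℝ K + 2 := by
  rw [vecEquiv.finrank_eq, Module.finrank_prod, Module.finrank_prod, Module.finrank_self]
  ring

theorem Octonion.finrank_eq_eight : Module.finrank ℝ Octonion = 8 := by
  change Module.finrank ℝ (Quaternion ℝ × Quaternion ℝ) = 8
  rw [Module.finrank_prod, Quaternion.finrank_eq_four]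

end Dimension

theorem mainTheorem8 :
    (Module.finrank ℝ (Vec ℝ) = 3 ∧ Module.finrank ℝ (Vec ℂ) = 4 ∧
      Module.finrank ℝ (Vec (Quaternion ℝ)) = 6 ∧ Module.finrank ℝ (Vec Octonion) = 10) ∧
    ∀ (K : Type*) [NonAssocRing K] [StarRing K] [Module ℝ K] [NormedDivisionAlgebra K],
      ∃ A : LInftySuperalgebra (SuperTranslation K × ℝ),
        A.IsLie 2 ∧
        A.CorrespondsTo (n := 1) (SuperRep.trivial (SuperTranslation K) ℝ) stringCocycle ∧
        A.IsExtension (SuperTranslation K) ℝ 1 ∧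
        ¬ A.IsExact 1 := by
  refine ⟨⟨?_, ?_, ?_, ?_⟩, fun K _ _ _ _ => ?_⟩
  · rw [finrank_vec, Module.finrank_self]
  · rw [finrank_vec, Complex.finrank_real_complex]
  · rw [finrank_vec, Quaternion.finrank_eq_four]
  · rw [finrank_vec, Octonion.finrank_eq_eight]
  · exact ⟨LInftySuperalgebra.ofCocycle stringCocycle stringCocycle_isEvenCocycle,
      LInftySuperalgebra.ofCocycle_isLie _ _, LInftySuperalgebra.ofCocycle_correspondsTo _ _,
      LInftySuperalgebra.ofCocycle_isExtension _ _,
      LInftySuperalgebra.ofCocycle_stringCocycle_not_isExact⟩
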